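/- A hypergraph is a triple $H=(V,E,i)$ of finite sets $V=V(H)$, $E=E(H)$ and a map $i:E\to 2^V$ with $|i(e)|\ge 2$ for all $e\in E$ (so parallel edges, i.e. $e\neq e'$ with $i(e)=i(e')$, are allowed); $H$ is simple if it has no parallel edges, and $|H|=|V|$. For $v\in V$ let $d_H(v)=|\{e\in E: v\in i(e)\}|$, let $d(H)=\sum_{v\in V}d_H(v)$, and let $\delta(H)=\min_{v} d_H(v)$ (with $\delta(H)=0$ if $V=\varnothing$). For $X\subseteq V$, $H[X]$ is the hypergraph with vertex set $X$, edges those $e$ with $i(e)\subseteq X$, and incidence function the restriction of $i$; $H-v=H[V\setminus\{v\}]$; and $H(X)$ is the hypergraph with vertex set $X$, edges those $e$ with $|i(e)\cap X|\ge2$, and incidence function $e\mapsto i(e)\cap X$. A hypergraph property $\mathcal P$ is an isomorphism-closed class of hypergraphs. It is smooth if it is closed under induced subhypergraphs $H[X]$, contains a hypergraph with at least one vertex, and does not contain all hypergraphs; it is additive if it is closed under vertex-disjoint unions. Let $\mathcal F(\mathcal P)$ be the class of all $H\notin\mathcal P$ with $H-v\in\mathcal P$ for all $v\in V(H)$, and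 let $d(\mathcal P)=\min\{\delta(H): H\in\mathcal F(\mathcal P)\}$. Let $C$ be a set of colors and let $L$ assign to each $v\in V(H)$ a list $L(v)\subseteq C$. A $(\mathcal P,L)$-coloring of $H$ is a map $\varphi:V(H)\to C$ with $\varphi(v)\in L(v)$ for all $v$ and $H[\varphi^{-1}(c)]\in\mathcal P$ for all $c\in C$. $H$ is $(\mathcal P,L)$-critical if $H$ has no $(\mathcal P,L)$-coloring, but $H-v$ has one (for the restricted lists) for every $v\in V(H)$. A $(\mathcal P,L)$-critical $H$ is locally linear with respect to $(\mathcal P,L)$ if $H(U)$ is simple, where $U=\{v\in V(H): d_H(v)=d(\mathcal P)\,|L(v)|\}$. **Theorem.** Let $\mathcal P$ be a smooth and additive hypergraph property with $d(\mathcal P)=r\ge1$, let $k\ge2$ be an integer, and let $\delta=kr\ge3$. Let $H$ be a hypergraph that is not isomorphic to the complete graph $K_{\delta+1}$, and let $L$ be a list-assignment for $H$ with $|L(v)|=k$ for all $v\in V(H)$, such that $H$ is $(\mathcal P,L)$-critical and locally linear with respect to $(\mathcal P,L)$. Then, with $n=|H|$, $$d(H)\ \ge\ \delta n+\frac{\delta-2}{\delta^2+2\delta-2}\,n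 .$$ -/

import Mathlib

universe u v

/-- A finite, undirected, loopless hypergraph `(V, E, i)`, parallel edges allowed: `V` and `E` are
finite and the incidence function `inc` sends every edge to a set of at least two vertices.
(Mathlib's `Hypergraph` has a set of edges and so cannot have parallel ones.) -/
structure MultiHypergraph : Type (u + 1) where
  /-- the vertices -/
  V : Type u
  /-- the edges -/
  E : Type u
  finite_V : Finite V
  finite_E : Finite E
  /-- the incidence function -/
  inc : E → Set V
  two_le_ncard_inc : ∀ e, 2 ≤ (inc e).ncard

namespace MultiHypergraph

attribute [instance] MultiHypergraph.finite_V MultiHypergraph.finite_E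

/-- The order `|H|`, the number of vertices. -/
noncomputable def order (H : MultiHypergraph.{u}) : ℕ := Nat.card H.V

/-- The degree `d_H(v)`, the number of edges incident to `v`. -/
noncomputable def degree (H : MultiHypergraph.{u}) (v : H.V) : ℕ :=
  {e : H.E | v ∈ H.inc e}.ncard

/-- The degree sum `d(H)` over all (finitely many) vertices. -/
noncomputable def degreeSum (H : MultiHypergraph.{u}) : ℕ := ∑ᶠ v : H.V, H.degree v

/-- The minimum degree `δ(H)`; an infimum over the empty type is `0` in `ℕ`, which is the
convention for the empty hypergraph. -/
noncomputable def minDegree (H : MultiHypergraph.{u}) : ℕ := ⨅ v : H.V, H.degree v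

/-- A hypergraph is simple if it has no two parallel edges. -/
def IsSimple (H : MultiHypergraph.{u}) : Prop :=
  ∀ e e' : H.E, H.inc e = H.inc e' → e = e'

/-- Isomorphisms of hypergraphs. -/
structure Iso (H K : MultiHypergraph.{u}) where
  /-- the bijection on vertices -/
  onV : H.V ≃ K.V
  /-- the bijection on edges -/
  onE : H.E ≃ K.E
  inc_onE : ∀ e, K.inc (onE e) = onV '' H.inc e

theorem ncard_preimage_val {α : Type u} (X s : Set α) :
    ((Subtype.val : X → α) ⁻¹' s).ncard = (s ∩ X).ncard := by
  rw [← Set.ncard_image_of_injective _ Subtype.val_injective, Subtype.image_preimage_coe,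
    Set.inter_comm]

/-- The induced subhypergraph `H[X]`: vertex set `X`, and the edges `e` with `i(e) ⊆ X`. -/
def induce (H : MultiHypergraph.{u}) (X : Set H.V) : MultiHypergraph.{u} where
  V := X
  E := {e : H.E // H.inc e ⊆ X}
  finite_V := inferInstance
  finite_E := inferInstance
  inc e := Subtype.val ⁻¹' H.inc e.1
  two_le_ncard_inc e := by
    rw [ncard_preimage_val, Set.inter_eq_left.2 e.2]
    exact H.two_le_ncard_inc e.1

/-- The hypergraph `H(X)` obtained by shrinking `H` to `X`: vertex set `X`, the edges `e` with
`|i(e) ∩ X| ≥ 2`, and the incidence function `e ↦ i(e) ∩ X`. -/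
def shrink (H : MultiHypergraph.{u}) (X : Set H.V) : MultiHypergraph.{u} where
  V := X
  E := {e : H.E // 2 ≤ (H.inc e ∩ X).ncard}
  finite_V := inferInstance
  finite_E := inferInstance
  inc e := Subtype.val ⁻¹' H.inc e.1
  two_le_ncard_inc e := by
    rw [ncard_preimage_val]
    exact e.2

/-- `H - v`, the subhypergraph induced by all vertices but `v`. -/
def deleteVertex (H : MultiHypergraph.{u}) (v : H.V) : MultiHypergraph.{u} :=
  H.induce {v}ᶜ

/-- The vertex disjoint union of two hypergraphs. -/
def disjUnion (H K : MultiHypergraph.{u}) : MultiHypergraph.{u} where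
  V := H.V ⊕ K.V
  E := H.E ⊕ K.E
  finite_V := inferInstance
  finite_E := inferInstance
  inc := Sum.elim (fun e => Sum.inl '' H.inc e) (fun e => Sum.inr '' K.inc e)
  two_le_ncard_inc e := by
    cases e with
    | inl e =>
      simpa [Set.ncard_image_of_injective _ Sum.inl_injective] using H.two_le_ncard_inc e
    | inr e =>
      simpa [Set.ncard_image_of_injective _ Sum.inr_injective] using K.two_le_ncard_inc e

/-- The complete graph `K_n`: `n` vertices, and every two-element set of vertices is an edge,
exactly once. -/
def complete (n : ℕ) : MultiHypergraph.{u} where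
  V := ULift.{u} (Fin n)
  E := {s : Set (ULift.{u} (Fin n)) // s.ncard = 2}
  finite_V := inferInstance
  finite_E := inferInstance
  inc e := e.1
  two_le_ncard_inc e := e.2.ge

end MultiHypergraph

/-- A hypergraph property: a class of hypergraphs closed under isomorphism. -/
structure HypergraphProperty : Type (u + 1) where
  /-- membership in the class -/
  Mem : MultiHypergraph.{u} → Prop
  mem_of_iso : ∀ H K : MultiHypergraph.{u}, Nonempty (H.Iso K) → Mem H → Mem K

namespace HypergraphProperty

open MultiHypergraph

/-- A property is smooth if it is hereditary (closed under induced subhypergraphs) and non-trivial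
(it contains a non-empty hypergraph, but not every hypergraph). -/
structure IsSmooth (P : HypergraphProperty.{u}) : Prop where
  hereditary : ∀ H : MultiHypergraph.{u}, P.Mem H → ∀ X : Set H.V, P.Mem (H.induce X)
  exists_mem : ∃ H : MultiHypergraph.{u}, Nonempty H.V ∧ P.Mem H
  exists_not_mem : ∃ H : MultiHypergraph.{u}, ¬ P.Mem H

/-- A property is additive if it is closed under vertex disjoint unions. -/
def IsAdditive (P : HypergraphProperty.{u}) : Prop :=
  ∀ H K : MultiHypergraph.{u}, P.Mem H → P.Mem K → P.Mem (H.disjUnion K)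

/-- The class `F(P)` of the hypergraphs `H` with `H ∉ P`, but `H - v ∈ P` for all vertices `v`. -/
def minimalForbidden (P : HypergraphProperty.{u}) : Set MultiHypergraph.{u} :=
  {H | ¬ P.Mem H ∧ ∀ v : H.V, P.Mem (H.deleteVertex v)}

/-- `d(P)`, the least minimum degree `δ(H)` of a hypergraph `H ∈ F(P)`. (The class `F(P)` is
non-empty for every smooth `P`.) -/
noncomputable def d (P : HypergraphProperty.{u}) : ℕ :=
  sInf (minDegree '' P.minimalForbidden)

/-- `H` is `(P, L)`-colorable: there is `φ : V(H) → C` with `φ(v) ∈ L(v)` for all `v`, such that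
every color class induces a member of `P`. -/
def Colorable (P : HypergraphProperty.{u}) {C : Type v} (H : MultiHypergraph.{u})
    (L : H.V → Set C) : Prop :=
  ∃ φ : H.V → C, (∀ c : C, P.Mem (H.induce (φ ⁻¹' {c}))) ∧ ∀ w, φ w ∈ L w

/-- `H` is `(P, L)`-critical: `H` is not `(P, L)`-colorable, but `H - v` is for every vertex `v`
(with the restricted lists). -/
def Critical (P : HypergraphProperty.{u}) {C : Type v} (H : MultiHypergraph.{u})
    (L : H.V → Set C) : Prop :=
  (∀ w : H.V, P.Colorable (H.deleteVertex w) (fun x => L x.1)) ∧ ¬ P.Colorable H L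

/-- The set `V(H, P, L)` of low vertices, those with `d_H(v) = d(P) |L(v)|`. -/
def lowVertices (P : HypergraphProperty.{u}) {C : Type v} (H : MultiHypergraph.{u})
    (L : H.V → Set C) : Set H.V :=
  {w | H.degree w = P.d * (L w).ncard}

/-- `H` is locally linear with respect to `(P, L)`: shrinking `H` to its low vertices gives a simple
hypergraph. -/
def LocallyLinear (P : HypergraphProperty.{u}) {C : Type v} (H : MultiHypergraph.{u})
    (L : H.V → Set C) : Prop :=
  (H.shrink (P.lowVertices H L)).IsSimple

end HypergraphProperty

/-! In a coloring of H - v every color of L(v) must be blocked at v, which takes at least d(P) edges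
whose other vertices all have that color (`IsColoringOff.le_ncard_colorEdges`). So all degrees are
at least δ. Let U be the set of low vertices, those of degree exactly δ; the others have degree at
least δ + 1. An edge meeting U in a single vertex also has a vertex outside U, so a small degree sum
in H(U) forces a large one outside U (`sum_degree_le_add`). The theorem is then a linear combination
of these facts with the bound δ ∑ d_{H(U)}(v) ≤ (δ² - δ + 2)|U|.

That bound rests on a Gallai-type description of the blocks of H(U)
(`Critical.degreeOn_le_or_regular`). At an uncolored low vertex all counts are tight: each color of
its list owns exactly d(P) edges, and these exhaust the edges there. Hence the color of a low
neighbor can be moved to the uncolored vertex, which uncolors the neighbor instead; `TokenGame`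
isolates what this shifting needs. On a biconnected board, a single color around the uncolored
vertex in one configuration persists in all configurations and at all positions (`monoAt_of_conf`,
`MonoAt.all`), and then degrees in the block are at most d(P). Comparing different routes of the
uncolored vertex produces this situation from an edge with two board vertices and a third vertex,
from a four-cycle with at most one chord, and from an induced cycle that misses part of the board.
Otherwise the block is a complete graph or an induced cycle. A complete block has degree below δ,
since H is connected and is not K_{δ+1}.

The degree bound follows by giving each vertex of H(U) a potential depending on its degree and
removing end blocks one at a time (`potential_nonneg`). No removal increases the total, so the total
is non-negative. -/

namespace MultiHypergraph

/-! ### Induced subhypergraphs and membership in a property -/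

/-- The inverse isomorphism. -/
def Iso.symm {H K : MultiHypergraph.{u}} (f : H.Iso K) : K.Iso H where
  onV := f.onV.symm
  onE := f.onE.symm
  inc_onE e := by
    obtain ⟨e, rfl⟩ := f.onE.surjective e
    rw [f.inc_onE, Equiv.symm_apply_apply, Equiv.symm_image_image]

theorem nonempty_iso_of_bijective {H K : MultiHypergraph.{u}} (f : H.V → K.V) (g : H.E → K.E)
    (hf : f.Bijective) (hg : g.Bijective) (h : ∀ e, K.inc (g e) = f '' H.inc e) :
    Nonempty (H.Iso K) :=
  ⟨⟨Equiv.ofBijective f hf, Equiv.ofBijective g hg, h⟩⟩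

theorem nonempty_iso_induce_induce (H : MultiHypergraph.{u}) (X : Set H.V)
    (Y : Set (H.induce X).V) :
    Nonempty (((H.induce X).induce Y).Iso (H.induce (Subtype.val '' Y))) := by
  refine nonempty_iso_of_bijective (fun y => ⟨y.1.1, y.1, y.2, rfl⟩)
    (fun e => ⟨e.1.1, fun x hx => ⟨⟨x, e.1.2 hx⟩, e.2 hx, rfl⟩⟩) ⟨?_, ?_⟩ ⟨?_, ?_⟩ ?_
  · intro a b hab
    exact Subtype.ext (Subtype.ext (congrArg (fun t => t.1) hab))
  · rintro ⟨_, y, hy, rfl⟩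
    exact ⟨⟨y, hy⟩, rfl⟩
  · intro a b hab
    exact Subtype.ext (Subtype.ext (congrArg (fun t => t.1) hab))
  · rintro ⟨e, he⟩
    refine ⟨⟨⟨e, fun x hx => ?_⟩, fun x hx => ?_⟩, rfl⟩
    · obtain ⟨y, -, rfl⟩ := he hx
      exact y.2
    · obtain ⟨y, hy, hyx⟩ := he hx
      rwa [← Subtype.ext hyx]
  · rintro ⟨⟨e, he⟩, he'⟩
    ext ⟨x, hx⟩
    constructor
    · intro hxe
      obtain ⟨y, hy, rfl⟩ := hx
      exact ⟨⟨y, hy⟩, hxe, rfl⟩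
    · rintro ⟨y, hy, hyx⟩
      have : y.1.1 = x := congrArg (fun t => t.1) hyx
      subst this
      exact hy

end MultiHypergraph

namespace HypergraphProperty

open MultiHypergraph

variable {P : HypergraphProperty.{u}} {H : MultiHypergraph.{u}}

theorem mem_induce_induce_iff {X : Set H.V} {Y : Set (H.induce X).V} :
    P.Mem ((H.induce X).induce Y) ↔ P.Mem (H.induce (Subtype.val '' Y)) := by
  obtain ⟨f⟩ := nonempty_iso_induce_induce H X Y
  exact ⟨P.mem_of_iso _ _ ⟨f⟩, P.mem_of_iso _ _ ⟨f.symm⟩⟩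

theorem IsSmooth.mem_induce_of_subset (hP : P.IsSmooth) {X Y : Set H.V} (h : Y ⊆ X)
    (hX : P.Mem (H.induce X)) : P.Mem (H.induce Y) := by
  have := mem_induce_induce_iff.1 (hP.hereditary _ hX (Subtype.val ⁻¹' Y : Set X))
  rwa [Subtype.image_preimage_coe, Set.inter_eq_right.2 h] at this

/-- The hypotheses place H[X] in F(P), and the edges counted are those of H[X] at v. -/
theorem d_le_of_minimal {X : Set H.V} (hX : ¬ P.Mem (H.induce X))
    (hmin : ∀ v ∈ X, P.Mem (H.induce (X \ {v}))) {v : H.V} (hv : v ∈ X) :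
    P.d ≤ {e | v ∈ H.inc e ∧ H.inc e ⊆ X}.ncard := by
  have hF : H.induce X ∈ P.minimalForbidden := by
    refine ⟨hX, fun w => mem_induce_induce_iff.2 ?_⟩
    have : (Subtype.val '' ({w}ᶜ : Set X)) = X \ {w.1} := by
      ext x
      simp only [Set.mem_image, Set.mem_compl_iff, Set.mem_singleton_iff, Set.mem_sdiff]
      constructor
      · rintro ⟨y, hy, rfl⟩
        exact ⟨y.2, fun h => hy (Subtype.ext h)⟩
      · rintro ⟨hx, hne⟩
        exact ⟨⟨x, hx⟩, fun h => hne (congrArg Subtype.val h), rfl⟩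
    exact this ▸ hmin w.1 w.2
  calc P.d ≤ (H.induce X).minDegree := Nat.sInf_le ⟨_, hF, rfl⟩
    _ ≤ (H.induce X).degree ⟨v, hv⟩ := ciInf_le (OrderBot.bddBelow _) _
    _ ≤ _ := by
      refine Set.ncard_le_ncard_of_injOn (fun e => e.1) ?_ ?_ (Set.toFinite _)
      · intro e he
        exact ⟨he, e.2⟩
      · exact fun a _ b _ h => Subtype.ext h

/-- Otherwise a minimal subset of `insert v X` inducing a non-member would contain v, and v would
have degree at least d(P) in it. -/
theorem IsSmooth.mem_induce_insert (hP : P.IsSmooth) {X : Set H.V} {v : H.V}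
    (hX : P.Mem (H.induce X)) (hdeg : {e | v ∈ H.inc e ∧ H.inc e ⊆ insert v X}.ncard < P.d) :
    P.Mem (H.induce (insert v X)) := by
  by_contra hcon
  obtain ⟨Y, hYX, hY⟩ := exists_minimal_le_of_wellFoundedLT
    (fun Y : Set H.V => ¬ P.Mem (H.induce Y)) _ hcon
  have hvY : v ∈ Y := by
    by_contra hv
    exact hY.prop (hP.mem_induce_of_subset ((Set.subset_insert_iff_of_notMem hv).1 hYX) hX)
  have := d_le_of_minimal hY.prop (fun w hw => by
    by_contra h
    exact (hY.le_of_le h Set.sdiff_subset hw).2 rfl) hvY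
  refine absurd (this.trans (Set.ncard_le_ncard ?_ (Set.toFinite _))) (not_le.2 hdeg)
  exact fun e he => ⟨he.1, he.2.trans hYX⟩

theorem IsAdditive.mem_induce_union (hP : P.IsAdditive) {X Y : Set H.V} (hXY : Disjoint X Y)
    (he : ∀ e, H.inc e ⊆ X ∪ Y → H.inc e ⊆ X ∨ H.inc e ⊆ Y)
    (hX : P.Mem (H.induce X)) (hY : P.Mem (H.induce Y)) : P.Mem (H.induce (X ∪ Y)) := by
  refine P.mem_of_iso _ _ ?_ (hP _ _ hX hY)
  refine nonempty_iso_of_bijective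
    (Sum.elim (fun x : X => ⟨x.1, Or.inl x.2⟩) (fun y : Y => ⟨y.1, Or.inr y.2⟩))
    (Sum.elim (fun e => ⟨e.1, e.2.trans Set.subset_union_left⟩)
      (fun e => ⟨e.1, e.2.trans Set.subset_union_right⟩)) ⟨?_, ?_⟩ ⟨?_, ?_⟩ ?_
  · rintro (a | a) (b | b) hab
    · exact congrArg Sum.inl (Subtype.ext (congrArg (fun t => t.1) hab))
    · have : a.1 = b.1 := congrArg (fun t => t.1) hab
      exact (Set.disjoint_left.1 hXY a.2 (this ▸ b.2)).elim
    · have : a.1 = b.1 := congrArg (fun t => t.1) hab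
      exact (Set.disjoint_left.1 hXY b.2 (this ▸ a.2)).elim
    · exact congrArg Sum.inr (Subtype.ext (congrArg (fun t => t.1) hab))
  · rintro ⟨x, hx | hx⟩
    · exact ⟨Sum.inl ⟨x, hx⟩, rfl⟩
    · exact ⟨Sum.inr ⟨x, hx⟩, rfl⟩
  · have key : ∀ e, H.inc e ⊆ X → H.inc e ⊆ Y → False := fun e h h' => by
      obtain ⟨x, hx⟩ := Set.nonempty_of_ncard_ne_zero
        (show (H.inc e).ncard ≠ 0 by have := H.two_le_ncard_inc e; omega)
      exact Set.disjoint_left.1 hXY (h hx) (h' hx)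
    rintro (a | a) (b | b) hab
    · exact congrArg Sum.inl (Subtype.ext (congrArg (fun t => t.1) hab))
    · have : a.1 = b.1 := congrArg (fun t => t.1) hab
      exact (key a.1 a.2 (this ▸ b.2)).elim
    · have : a.1 = b.1 := congrArg (fun t => t.1) hab
      exact (key b.1 b.2 (this ▸ a.2)).elim
    · exact congrArg Sum.inr (Subtype.ext (congrArg (fun t => t.1) hab))
  · rintro ⟨e, h⟩
    rcases he e h with h' | h'
    · exact ⟨Sum.inl ⟨e, h'⟩, rfl⟩
    · exact ⟨Sum.inr ⟨e, h'⟩, rfl⟩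
  · rintro (e | e)
    · ext ⟨x, hx⟩
      constructor
      · intro hxe
        exact ⟨Sum.inl ⟨x, e.2 hxe⟩, ⟨_, hxe, rfl⟩, rfl⟩
      · rintro ⟨_, ⟨y, hy, rfl⟩, hyx⟩
        have : y.1 = x := congrArg (fun t => t.1) hyx
        subst this
        exact hy
    · ext ⟨x, hx⟩
      constructor
      · intro hxe
        exact ⟨Sum.inr ⟨x, e.2 hxe⟩, ⟨_, hxe, rfl⟩, rfl⟩
      · rintro ⟨_, ⟨y, hy, rfl⟩, hyx⟩
        have : y.1 = x := congrArg (fun t => t.1) hyx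
        subst this
        exact hy

end HypergraphProperty

/-! ### Color classes at a vertex and the abstract shifting game -/

namespace MultiHypergraph

/-- The graph in which two distinct vertices are adjacent when they lie on a common edge. -/
def twoSection (H : MultiHypergraph.{u}) : SimpleGraph H.V where
  Adj x y := x ≠ y ∧ ∃ e, x ∈ H.inc e ∧ y ∈ H.inc e
  symm := ⟨fun _ _ h => ⟨h.1.symm, h.2.imp fun _ he => he.symm⟩⟩
  loopless := ⟨fun _ h => h.1 rfl⟩

theorem exists_mem_inc_ne (H : MultiHypergraph.{u}) (e : H.E) (v : H.V) :
    ∃ w ∈ H.inc e, w ≠ v :=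
  Set.exists_ne_of_one_lt_ncard (H.two_le_ncard_inc e) v

/-- The edges at `v` all of whose other vertices have color `c`. -/
def colorEdges (H : MultiHypergraph.{u}) {C : Type v} (v : H.V) (φ : H.V → C) (c : C) : Set H.E :=
  {e | v ∈ H.inc e ∧ ∀ w ∈ H.inc e, w ≠ v → φ w = c}

theorem disjoint_colorEdges (H : MultiHypergraph.{u}) {C : Type v} (v : H.V) (φ : H.V → C)
    {c c' : C} (h : c ≠ c') : Disjoint (H.colorEdges v φ c) (H.colorEdges v φ c') := by
  refine Set.disjoint_left.2 fun e he he' => h ?_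
  obtain ⟨w, hw, hwv⟩ := H.exists_mem_inc_ne e v
  exact (he.2 w hw hwv).symm.trans (he'.2 w hw hwv)

/-- Abstract form of the color shifting argument in a critical hypergraph: one vertex `v` of the
board is uncolored, and the color of a neighbor on the board may be moved to `v`. -/
structure TokenGame (H : MultiHypergraph.{u}) (C : Type v) where
  /-- the set of possible positions of the uncolored vertex -/
  board : Set H.V
  /-- `conf v φ`: `φ` is an admissible coloring of all vertices but `v` -/
  conf : H.V → (H.V → C) → Prop
  /-- the number of edges at the uncolored vertex in each color that occurs there -/
  mult : ℕ
  /-- the colors that may occur at the neighbors of an uncolored vertex -/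
  list : H.V → Set C
  mem_board : ∀ {v φ}, conf v φ → v ∈ board
  eq_outside : ∀ {v φ w ψ}, conf v φ → conf w ψ → ∀ z ∉ board, φ z = ψ z
  move : ∀ {v φ u}, conf v φ → u ∈ board → H.twoSection.Adj v u →
    ∃ ψ, conf u ψ ∧ ψ v = φ u ∧ ∀ z, z ≠ v → ψ z = φ z
  monochromatic : ∀ {v φ e x y}, conf v φ → v ∈ H.inc e → x ∈ H.inc e → y ∈ H.inc e → x ≠ v →
    y ≠ v → φ x = φ y
  mem_list : ∀ {v φ u}, conf v φ → H.twoSection.Adj v u → φ u ∈ list v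
  ncard_colorEdges : ∀ {v φ c}, conf v φ → c ∈ list v → (H.colorEdges v φ c).ncard = mult

end MultiHypergraph

/-! ### Colorings of H - v in a critical hypergraph -/

namespace HypergraphProperty

open MultiHypergraph

variable {P : HypergraphProperty.{u}} {H : MultiHypergraph.{u}} {C : Type v} {L : H.V → Set C}

/-- `φ` is a `(P, L)`-coloring of `H - v`; its value at `v` is irrelevant. -/
def IsColoringOff (P : HypergraphProperty.{u}) (H : MultiHypergraph.{u}) {C : Type v}
    (L : H.V → Set C) (v : H.V) (φ : H.V → C) : Prop :=
  (∀ c, P.Mem (H.induce (φ ⁻¹' {c} \ {v}))) ∧ ∀ w, w ≠ v → φ w ∈ L w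

theorem Critical.exists_isColoringOff (h : P.Critical H L) (v : H.V) (hv : (L v).Nonempty) :
    ∃ φ, P.IsColoringOff H L v φ := by
  classical
  obtain ⟨c₀, -⟩ := hv
  obtain ⟨φ, hφ, hL⟩ := h.1 v
  have hext : ∀ (w : H.V) (hw : w ≠ v),
      (fun x => if hx : x ≠ v then φ ⟨x, hx⟩ else c₀) w = φ ⟨w, hw⟩ :=
    fun w hw => dif_pos hw
  refine ⟨fun x => if hx : x ≠ v then φ ⟨x, hx⟩ else c₀, fun c => ?_, fun w hw => ?_⟩
  · have := mem_induce_induce_iff.1 (hφ c)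
    convert this using 2
    ext x
    constructor
    · rintro ⟨hx, hxv⟩
      exact ⟨⟨x, hxv⟩, (hext x hxv).symm.trans hx, rfl⟩
    · rintro ⟨⟨x, hxv⟩, hx, rfl⟩
      exact ⟨(hext x hxv).trans hx, hxv⟩
  · rw [hext w hw]
    exact hL ⟨w, hw⟩

theorem IsColoringOff.mem_of_ncard_lt (hP : P.IsSmooth) {v : H.V} {φ : H.V → C}
    (h : P.IsColoringOff H L v φ) {c : C} (X : Set H.V) (hXφ : ∀ x ∈ X, x ≠ v → φ x = c)
    (hX : {e | v ∈ H.inc e ∧ H.inc e ⊆ insert v X}.ncard < P.d) : P.Mem (H.induce X) := by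
  have h1 : X \ {v} ⊆ φ ⁻¹' {c} \ {v} := fun x hx => ⟨hXφ x hx.1 hx.2, hx.2⟩
  have h2 := hP.mem_induce_of_subset h1 (h.1 c)
  have h3 : insert v (X \ {v}) = insert v X := Set.insert_sdiff_singleton
  refine hP.mem_induce_of_subset (Set.subset_insert v X) ?_
  rw [← h3]
  exact hP.mem_induce_insert h2 (by rwa [h3])

/-- With fewer edges, v could join the class of c without leaving P, and H would be colorable. -/
theorem IsColoringOff.le_ncard_colorEdges (hP : P.IsSmooth) (hH : ¬ P.Colorable H L) {v : H.V}
    {φ : H.V → C} (h : P.IsColoringOff H L v φ) {c : C} (hc : c ∈ L v) :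
    P.d ≤ (H.colorEdges v φ c).ncard := by
  classical
  by_contra! hlt
  refine hH ⟨Function.update φ v c, fun c' => ?_, fun w => ?_⟩
  · by_cases hcc : c' = c
    · subst hcc
      refine h.mem_of_ncard_lt hP (c := c') _ (fun x hx hxv => ?_)
        (lt_of_le_of_lt (Set.ncard_le_ncard ?_ (Set.toFinite _)) hlt)
      · simpa [hxv] using hx
      · rintro e ⟨hve, he⟩
        refine ⟨hve, fun w hw hwv => ?_⟩
        have := (he hw).resolve_left hwv
        simpa [hwv] using this
    · refine hP.mem_induce_of_subset (fun x hx => ?_) (h.1 c')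
      by_cases hxv : x = v
      · subst hxv
        exact (hcc (by simpa using hx.symm)).elim
      · exact ⟨by simpa [hxv] using hx, hxv⟩
  · by_cases hw : w = v
    · subst hw
      simpa using hc
    · simpa [hw] using h.2 w hw

theorem sum_ncard_colorEdges {v : H.V} {φ : H.V → C} (s : Finset C) :
    ∑ c ∈ s, (H.colorEdges v φ c).ncard = (⋃ c ∈ s, H.colorEdges v φ c).ncard := by
  classical
  induction s using Finset.induction_on with
  | empty => simp
  | insert c s hc ih =>
    rw [Finset.sum_insert hc, ih, Finset.set_biUnion_insert,
      Set.ncard_union_eq _ (Set.toFinite _) (Set.toFinite _)]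
    simp only [Set.disjoint_iUnion_right]
    exact fun c' hc' => H.disjoint_colorEdges v φ (fun h => hc (h ▸ hc'))

theorem iUnion_colorEdges_subset {v : H.V} {φ : H.V → C} (s : Finset C) :
    (⋃ c ∈ s, H.colorEdges v φ c) ⊆ {e | v ∈ H.inc e} := by
  simp only [Set.iUnion_subset_iff]
  exact fun _ _ e he => he.1

theorem IsColoringOff.mul_le_degree (hP : P.IsSmooth) (hH : ¬ P.Colorable H L) {v : H.V}
    {φ : H.V → C} (h : P.IsColoringOff H L v φ) (hL : (L v).Finite) :
    P.d * (L v).ncard ≤ H.degree v := by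
  classical
  calc P.d * (L v).ncard = ∑ c ∈ hL.toFinset, P.d := by
        rw [Finset.sum_const, Set.ncard_eq_toFinset_card _ hL, smul_eq_mul, mul_comm]
    _ ≤ ∑ c ∈ hL.toFinset, (H.colorEdges v φ c).ncard :=
        Finset.sum_le_sum fun c hc => h.le_ncard_colorEdges hP hH (hL.mem_toFinset.1 hc)
    _ ≤ H.degree v := by
        rw [sum_ncard_colorEdges]
        exact Set.ncard_le_ncard (iUnion_colorEdges_subset _) (Set.toFinite _)

/-- This is the equality case of `IsColoringOff.mul_le_degree`: the disjoint color classes of edges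
at v already use up the whole degree. -/
theorem IsColoringOff.low (hP : P.IsSmooth) (hH : ¬ P.Colorable H L) {v : H.V}
    {φ : H.V → C} (h : P.IsColoringOff H L v φ) (hL : (L v).Finite)
    (hlow : v ∈ P.lowVertices H L) :
    (∀ c ∈ L v, (H.colorEdges v φ c).ncard = P.d) ∧
      ∀ e, v ∈ H.inc e → ∃ c ∈ L v, e ∈ H.colorEdges v φ c := by
  classical
  have hlow' : H.degree v = P.d * (L v).ncard := hlow
  have h1 : ∑ c ∈ hL.toFinset, P.d = H.degree v := by
    rw [hlow', Finset.sum_const, Set.ncard_eq_toFinset_card _ hL, smul_eq_mul, mul_comm]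
  have h2 : ∀ c ∈ hL.toFinset, P.d ≤ (H.colorEdges v φ c).ncard :=
    fun c hc => h.le_ncard_colorEdges hP hH (hL.mem_toFinset.1 hc)
  have h3 : (⋃ c ∈ hL.toFinset, H.colorEdges v φ c).ncard ≤ H.degree v :=
    Set.ncard_le_ncard (iUnion_colorEdges_subset _) (Set.toFinite _)
  have h4 : ∑ c ∈ hL.toFinset, P.d = ∑ c ∈ hL.toFinset, (H.colorEdges v φ c).ncard := by
    refine le_antisymm (Finset.sum_le_sum h2) ?_
    rw [h1, sum_ncard_colorEdges]
    exact h3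
  constructor
  · intro c hc
    exact ((Finset.sum_eq_sum_iff_of_le h2).1 h4 c (hL.mem_toFinset.2 hc)).symm
  · have h5 : (⋃ c ∈ hL.toFinset, H.colorEdges v φ c) = {e | v ∈ H.inc e} := by
      refine Set.eq_of_subset_of_ncard_le (iUnion_colorEdges_subset _) ?_ (Set.toFinite _)
      rw [← sum_ncard_colorEdges, ← h4, h1]
      exact le_rfl
    intro e he
    have : e ∈ ⋃ c ∈ hL.toFinset, H.colorEdges v φ c := h5 ▸ he
    simpa using this

/-- Once u leaves its class, the edge e no longer obstructs v there. Fewer than d(P) obstructing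
edges remain, so v may enter. -/
theorem IsColoringOff.move (hP : P.IsSmooth) {v u : H.V} {φ ψ : H.V → C}
    (h : P.IsColoringOff H L v φ) (hu : φ u ∈ L v)
    (hcount : (H.colorEdges v φ (φ u)).ncard = P.d) {e : H.E} (hve : v ∈ H.inc e)
    (hue : u ∈ H.inc e) (hvu : v ≠ u) (he : e ∈ H.colorEdges v φ (φ u))
    (hψv : ψ v = φ u) (hψ : ∀ z, z ≠ v → ψ z = φ z) : P.IsColoringOff H L u ψ := by
  refine ⟨fun c => ?_, fun w hw => ?_⟩
  · by_cases hc : c = φ u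
    · subst hc
      refine h.mem_of_ncard_lt hP (c := φ u) _ (fun x hx hxv => ?_) ?_
      · rw [← hψ x hxv]
        exact hx.1
      · rw [← hcount]
        refine Set.ncard_lt_ncard ⟨?_, fun hsub => ?_⟩ (Set.toFinite _)
        · rintro e' ⟨h1, h2⟩
          refine ⟨h1, fun w hw hwv => ?_⟩
          rw [← hψ w hwv]
          exact ((h2 hw).resolve_left hwv).1
        · exact ((hsub he).2 hue).elim (fun h => hvu h.symm) fun h => h.2 rfl
    · refine hP.mem_induce_of_subset (fun x hx => ?_) (h.1 c)
      have hxv : x ≠ v := by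
        rintro rfl
        exact hc (hx.1.symm.trans hψv)
      exact ⟨(hψ x hxv).symm.trans hx.1, hxv⟩
  · by_cases hwv : w = v
    · subst hwv
      rwa [hψv]
    · rw [hψ w hwv]
      exact h.2 w hwv

/-- The token game of a critical hypergraph on a set of low vertices, relative to a fixed coloring
of the other vertices. -/
noncomputable def tokenGame (hP : P.IsSmooth) (hH : ¬ P.Colorable H L) (hL : ∀ v, (L v).Finite)
    (B : Set H.V) (hB : B ⊆ P.lowVertices H L) (φ₀ : H.V → C) : TokenGame H C where
  board := B
  conf v φ := v ∈ B ∧ P.IsColoringOff H L v φ ∧ ∀ z ∉ B, φ z = φ₀ z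
  mult := P.d
  list := L
  mem_board h := h.1
  eq_outside h h' z hz := (h.2.2 z hz).trans (h'.2.2 z hz).symm
  move := by
    classical
    rintro v φ u ⟨hv, h, hout⟩ hu ⟨hvu, e, hve, hue⟩
    obtain ⟨h1, h2⟩ := h.low hP hH (hL v) (hB hv)
    obtain ⟨c, hc, he⟩ := h2 e hve
    have hφu : φ u = c := he.2 u hue hvu.symm
    subst hφu
    have hψ : ∀ z, z ≠ v → Function.update φ v (φ u) z = φ z :=
      fun z hz => Function.update_of_ne hz _ _
    refine ⟨Function.update φ v (φ u), ⟨hu, ?_, fun z hz => ?_⟩, Function.update_self _ _ _, hψ⟩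
    · exact h.move hP hc (h1 _ hc) hve hue hvu he (Function.update_self _ _ _) hψ
    · rw [hψ z (fun h => hz (h ▸ hv)), hout z hz]
  monochromatic := by
    rintro v φ e x y ⟨hv, h, hout⟩ hve hx hy hxv hyv
    obtain ⟨c, hc, he⟩ := (h.low hP hH (hL v) (hB hv)).2 e hve
    exact (he.2 x hx hxv).trans (he.2 y hy hyv).symm
  mem_list := by
    rintro v φ u ⟨hv, h, hout⟩ ⟨hvu, e, hve, hue⟩
    obtain ⟨c, hc, he⟩ := (h.low hP hH (hL v) (hB hv)).2 e hve
    exact he.2 u hue hvu.symm ▸ hc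
  ncard_colorEdges := fun ⟨hv, h, _⟩ hc => (h.low hP hH (hL _) (hB hv)).1 _ hc

end HypergraphProperty

/-! ### Shifting colors on a biconnected board -/

/-- `S` induces a connected (or empty) subgraph of `G`: every non-empty subset of `S` that is closed
under adjacency within `S` is all of `S`. -/
def SimpleGraph.ConnectedOn {V : Type*} (G : SimpleGraph V) (S : Set V) : Prop :=
  ∀ A ⊆ S, A.Nonempty → (∀ a ∈ A, ∀ b ∈ S, G.Adj a b → b ∈ A) → A = S

/-- `S` induces a connected subgraph of `G` without cut vertices. -/
def SimpleGraph.BiconnectedOn {V : Type*} (G : SimpleGraph V) (S : Set V) : Prop :=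
  G.ConnectedOn S ∧ ∀ x ∈ S, G.ConnectedOn (S \ {x})

namespace MultiHypergraph

/-- The number of edges at `v` that contain a further vertex of `S`; for `v ∈ S` this is the degree
of `v` in `H(S)`. -/
noncomputable def degreeOn (H : MultiHypergraph.{u}) (S : Set H.V) (v : H.V) : ℕ :=
  {e | v ∈ H.inc e ∧ ∃ w ∈ S, w ≠ v ∧ w ∈ H.inc e}.ncard

namespace TokenGame

variable {H : MultiHypergraph.{u}} {C : Type v} (T : TokenGame H C)

theorem exists_conf {S : Set H.V} (hS : H.twoSection.ConnectedOn S) (hSB : S ⊆ T.board)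
    {t s : H.V} {φ : H.V → C} (h : T.conf t φ) (ht : t ∈ S) (hs : s ∈ S) :
    ∃ ψ, T.conf s ψ ∧ ∀ z ∉ S, ψ z = φ z := by
  have := hS {s ∈ S | ∃ ψ, T.conf s ψ ∧ ∀ z ∉ S, ψ z = φ z} (Set.sep_subset _ _)
    ⟨t, ht, φ, h, fun _ _ => rfl⟩ (by
      rintro a ⟨ha, ψ, hψ, hout⟩ b hb hab
      obtain ⟨χ, h1, -, h2⟩ := T.move hψ (hSB hb) hab
      exact ⟨hb, χ, h1, fun z hz => (h2 z fun h => hz (h ▸ ha)).trans (hout z hz)⟩)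
  rw [← this] at hs
  exact hs.2

/-- Walk the uncolored vertex inside S until it first hits D. A move recolors only the vertex being
left, so D keeps its colors. The route, and hence y, does not depend on the coloring. -/
theorem exists_return {S D : Set H.V} (hS : H.twoSection.ConnectedOn S) (hSB : S ⊆ T.board)
    {t : H.V} (ht : t ∈ S) (hD : (D ∩ S).Nonempty) :
    ∃ y ∈ D ∩ S, ∀ φ, T.conf t φ →
      ∃ ψ, T.conf y ψ ∧ (∀ z ∉ S, ψ z = φ z) ∧ ∀ z ∈ D, z ≠ y → ψ z = φ z := by
  by_contra! hcon
  have htD : t ∉ D := by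
    intro htD
    obtain ⟨φ, hφ, h⟩ := hcon t ⟨htD, ht⟩
    obtain ⟨z, -, -, hz⟩ := h φ hφ (fun _ _ => rfl)
    exact hz rfl
  have := hS {s ∈ S | s ∉ D ∧ ∀ φ, T.conf t φ → ∃ ψ, T.conf s ψ ∧ (∀ z ∉ S, ψ z = φ z) ∧
      ∀ z ∈ D, ψ z = φ z} (Set.sep_subset _ _)
    ⟨t, ht, htD, fun φ hφ => ⟨φ, hφ, fun _ _ => rfl, fun _ _ => rfl⟩⟩ (by
      rintro a ⟨ha, haD, h⟩ b hb hab
      have key : ∀ φ, T.conf t φ → ∃ ψ, T.conf b ψ ∧ (∀ z ∉ S, ψ z = φ z) ∧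
          ∀ z ∈ D, ψ z = φ z := by
        intro φ hφ
        obtain ⟨ψ, hψ, h1, h2⟩ := h φ hφ
        obtain ⟨χ, h3, -, h4⟩ := T.move hψ (hSB hb) hab
        exact ⟨χ, h3, fun z hz => (h4 z fun h => hz (h ▸ ha)).trans (h1 z hz),
          fun z hz => (h4 z fun h => haD (h ▸ hz)).trans (h2 z hz)⟩
      refine ⟨hb, fun hbD => ?_, key⟩
      obtain ⟨φ, hφ, h5⟩ := hcon b ⟨hbD, hb⟩
      obtain ⟨ψ, h6, h7, h8⟩ := key φ hφ
      obtain ⟨z, hz, -, hne⟩ := h5 ψ h6 h7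
      exact hne (h8 z hz))
  obtain ⟨y, hyD, hyS⟩ := hD
  rw [← this] at hyS
  exact hyS.2.1 hyD

/-- Whenever the uncolored vertex is `v`, all its neighbors on the board have color `c`. -/
def MonoAt (c : C) (v : H.V) : Prop :=
  ∀ φ, T.conf v φ → ∀ w ∈ T.board, H.twoSection.Adj v w → φ w = c

variable {T}

/-- Colors off the board are the same in all configurations. So the edges of color c at v under ψ
have color c under φ as well; the two classes have equal size and therefore coincide, and every edge
from v to the board belongs to the class under φ. -/
theorem monoAt_of_conf {c : C} {v : H.V} {φ : H.V → C} (h : T.conf v φ)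
    (hφ : ∀ w ∈ T.board, H.twoSection.Adj v w → φ w = c) : T.MonoAt c v := by
  intro ψ hψ w hw hvw
  have hc : c ∈ T.list v := hφ w hw hvw ▸ T.mem_list h hvw
  obtain ⟨hne, e, hve, hwe⟩ := hvw
  have hmem : ∀ e', v ∈ H.inc e' → ∀ x ∈ H.inc e', x ∈ T.board → x ≠ v →
      e' ∈ H.colorEdges v φ c := by
    intro e' hv x hx hxB hxv
    refine ⟨hv, fun y hy hyv => ?_⟩
    rw [T.monochromatic h hv hy hx hyv hxv]
    exact hφ x hxB ⟨hxv.symm, e', hv, hx⟩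
  have hsub : H.colorEdges v ψ c ⊆ H.colorEdges v φ c := by
    rintro e' ⟨hv, he'⟩
    by_cases hx : ∃ x ∈ H.inc e', x ∈ T.board ∧ x ≠ v
    · obtain ⟨x, hx, hxB, hxv⟩ := hx
      exact hmem e' hv x hx hxB hxv
    · refine ⟨hv, fun y hy hyv => ?_⟩
      rw [← he' y hy hyv]
      exact T.eq_outside h hψ y fun hyB => hx ⟨y, hy, hyB, hyv⟩
  have heq := Set.eq_of_subset_of_ncard_le hsub
    (by rw [T.ncard_colorEdges h hc, T.ncard_colorEdges hψ hc]) (Set.toFinite _)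
  have he : e ∈ H.colorEdges v ψ c := heq ▸ hmem e hve w hwe hw hne.symm
  exact he.2 w hwe hne.symm

/-- Since w is not a cut vertex, the uncolored vertex can be brought to v without touching the color
of w. -/
theorem MonoAt.eq_adj {c : C} {v : H.V} (hm : T.MonoAt c v)
    (hB : H.twoSection.BiconnectedOn T.board) (hv : v ∈ T.board) {t w : H.V} {φ : H.V → C}
    (h : T.conf t φ) (hw : w ∈ T.board) (hvw : H.twoSection.Adj v w) (hwt : w ≠ t) :
    φ w = c := by
  obtain ⟨ψ, hψ, h1⟩ := T.exists_conf (hB.2 w hw) Set.sdiff_subset h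
    ⟨T.mem_board h, hwt.symm⟩ (s := v) ⟨hv, hvw.1⟩
  rw [← h1 w (fun hh => hh.2 rfl)]
  exact hm ψ hψ w hw hvw

/-- The property spreads along an adjacency a, b: if b is uncolored, move the color of a neighbor x
to b. Now b is a colored neighbor of a, so that color is c. -/
theorem MonoAt.all {c : C} {v : H.V} (hm : T.MonoAt c v)
    (hB : H.twoSection.BiconnectedOn T.board) (hv : v ∈ T.board) {w : H.V} (hw : w ∈ T.board) :
    T.MonoAt c w := by
  have := hB.1 {w ∈ T.board | T.MonoAt c w} (Set.sep_subset _ _) ⟨v, hv, hm⟩ (by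
    rintro a ⟨ha, ham⟩ b hb hab
    refine ⟨hb, fun φ hφ x hx hbx => ?_⟩
    obtain ⟨ψ, h1, h2, -⟩ := T.move hφ hx hbx
    rw [← h2]
    exact ham.eq_adj hB ha h1 hb hab hbx.1)
  rw [← this] at hw
  exact hw.2

/-- All edges from v to the board lie in one color class at v, which has `T.mult` edges. -/
theorem MonoAt.degreeOn_le {c : C} {v : H.V} (hm : T.MonoAt c v) {φ : H.V → C}
    (h : T.conf v φ) : H.degreeOn T.board v ≤ T.mult := by
  by_cases hw : ∃ w ∈ T.board, H.twoSection.Adj v w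
  · obtain ⟨w, hw, hvw⟩ := hw
    have hc : c ∈ T.list v := hm φ h w hw hvw ▸ T.mem_list h hvw
    rw [← T.ncard_colorEdges h hc]
    refine Set.ncard_le_ncard ?_ (Set.toFinite _)
    rintro e ⟨hve, x, hx, hxv, hxe⟩
    refine ⟨hve, fun y hy hyv => ?_⟩
    rw [T.monochromatic h hve hy hxe hyv hxv]
    exact hm φ h x hx ⟨hxv.symm, e, hve, hxe⟩
  · have : {e | v ∈ H.inc e ∧ ∃ w ∈ T.board, w ≠ v ∧ w ∈ H.inc e} = ∅ := by
      refine Set.eq_empty_of_forall_notMem ?_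
      rintro e ⟨hve, x, hx, hxv, hxe⟩
      exact hw ⟨x, hx, hxv.symm, e, hve, hxe⟩
    rw [degreeOn, this, Set.ncard_empty]
    exact Nat.zero_le _

theorem MonoAt.degreeOn_le_of_mem {c : C} {v : H.V} (hm : T.MonoAt c v)
    (hB : H.twoSection.BiconnectedOn T.board) (hv : v ∈ T.board) {t : H.V} {φ : H.V → C}
    (h : T.conf t φ) {w : H.V} (hw : w ∈ T.board) : H.degreeOn T.board w ≤ T.mult := by
  obtain ⟨ψ, hψ, -⟩ := T.exists_conf hB.1 le_rfl h (T.mem_board h) hw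
  exact (hm.all hB hv hw).degreeOn_le hψ

/-- Move the color of an arbitrary neighbor t to a, then return to e at some y while avoiding a. The
edge e is monochromatic off y, so the old color of t is the color of e. The third vertex w, possibly
off the board, serves as witness when y is b. -/
theorem exists_monoAt_of_edge (hB : H.twoSection.BiconnectedOn T.board) {e : H.E} {a b w : H.V}
    (ha : a ∈ T.board) (hb : b ∈ T.board) (hae : a ∈ H.inc e) (hbe : b ∈ H.inc e)
    (hwe : w ∈ H.inc e) (hab : b ≠ a) (hwa : w ≠ a) (hwb : w ≠ b) {φ : H.V → C}
    (h : T.conf a φ) : T.MonoAt (φ b) a := by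
  refine monoAt_of_conf h fun t ht hat => ?_
  obtain ⟨ψ, hψ, h1, h2⟩ := T.move h ht hat
  obtain ⟨y, ⟨hyD, hyS⟩, hy⟩ := T.exists_return (D := H.inc e) (hB.2 a ha) Set.sdiff_subset
    (t := t) ⟨ht, hat.1.symm⟩ ⟨b, hbe, hb, hab⟩
  obtain ⟨χ, hχ, h3, h4⟩ := hy ψ hψ
  have hya : a ≠ y := fun hh => hyS.2 hh.symm
  have key : ∀ z ∈ H.inc e, z ≠ a → z ≠ y → φ t = φ z := by
    intro z hz hza hzy
    rw [← h2 z hza, ← h4 z hz hzy, ← h1, ← h3 a fun hh => hh.2 rfl]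
    exact T.monochromatic hχ hyD hae hz hya hzy
  by_cases hby : b = y
  · rw [key w hwe hwa (hby ▸ hwb)]
    exact T.monochromatic h hae hwe hbe hwa hab
  · exact key b hbe hab hby

/-- Both configurations have `T.mult` edges of each listed color at v and differ only at x and y.
Matching one color across x and y forces the other to match. -/
theorem eq_of_exchange (hpair : ∀ e, ∀ a ∈ T.board, ∀ b ∈ T.board, a ≠ b →
      a ∈ H.inc e → b ∈ H.inc e → H.inc e = {a, b})
    {v x y : H.V} {φ ψ : H.V → C} (hφ : T.conf v φ) (hψ : T.conf v ψ)
    (hx : x ∈ T.board) (hy : y ∈ T.board) (hvx : H.twoSection.Adj v x)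
    (hvy : H.twoSection.Adj v y)
    (hagree : ∀ w ∈ T.board, H.twoSection.Adj v w → w ≠ x → w ≠ y → φ w = ψ w)
    (hxy : φ x = ψ y) : φ y = ψ x := by
  by_contra hne
  have hv := T.mem_board hφ
  have hc : φ y ∈ T.list v := T.mem_list hφ hvy
  have hedge : ∀ e u, u ∈ T.board → u ≠ v → v ∈ H.inc e → u ∈ H.inc e → ∀ (χ : H.V → C) c,
      χ u = c → e ∈ H.colorEdges v χ c := by
    intro e u hu huv hve hue χ c hχ
    refine ⟨hve, fun w hw hwv => ?_⟩
    rw [hpair e v hv u hu huv.symm hve hue] at hw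
    rw [hw.resolve_left hwv, hχ]
  have hsub : H.colorEdges v ψ (φ y) ⊆ H.colorEdges v φ (φ y) := by
    rintro e ⟨hve, he⟩
    by_cases hxe : x ∈ H.inc e
    · exact (hne (he x hxe hvx.1.symm).symm).elim
    by_cases hye : y ∈ H.inc e
    · exact hedge e y hy hvy.1.symm hve hye φ _ rfl
    refine ⟨hve, fun w hw hwv => ?_⟩
    rw [← he w hw hwv]
    by_cases hwB : w ∈ T.board
    · exact hagree w hwB ⟨hwv.symm, e, hve, hw⟩ (fun hh => hxe (hh ▸ hw)) fun hh => hye (hh ▸ hw)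
    · exact T.eq_outside hφ hψ w hwB
  have heq := Set.eq_of_subset_of_ncard_le hsub
    (by rw [T.ncard_colorEdges hφ hc, T.ncard_colorEdges hψ hc]) (Set.toFinite _)
  obtain ⟨hvy', ey, hvey, hyey⟩ := hvy
  obtain ⟨hvx', ex, hvex, hxex⟩ := hvx
  have h1 : ey ∈ H.colorEdges v ψ (φ y) := heq ▸ hedge ey y hy hvy'.symm hvey hyey φ _ rfl
  have h2 := h1.2 y hyey hvy'.symm
  have h3 : ex ∈ H.colorEdges v ψ (φ y) :=
    heq ▸ hedge ex x hx hvx'.symm hvex hxex φ _ (hxy.trans h2)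
  exact hne (h3.2 x hxex hvx'.symm).symm

end TokenGame

end MultiHypergraph

/-! ### Cycles on the board -/

namespace MultiHypergraph

namespace TokenGame

variable {H : MultiHypergraph.{u}} {C : Type v} {T : TokenGame H C}

/-- A cycle of length `m` on the board, parametrized periodically by the integers. -/
structure BoardCycle (T : TokenGame H C) (m : ℕ) (c : ℤ → H.V) : Prop where
  four_le : 4 ≤ m
  mem : ∀ i, c i ∈ T.board
  period : ∀ i : ℤ, c (i + m) = c i
  ne : ∀ i j : ℤ, i < j → j < i + m → c i ≠ c j
  adj : ∀ i, H.twoSection.Adj (c i) (c (i + 1))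

/-- No chord of the cycle `c` ends at `c k`. -/
def Chordless (H : MultiHypergraph.{u}) (c : ℤ → H.V) (k : ℤ) : Prop :=
  ∀ j, H.twoSection.Adj (c k) (c j) → c j = c (k - 1) ∨ c j = c (k + 1)

theorem BoardCycle.shift {m : ℕ} {c : ℤ → H.V} (hc : T.BoardCycle m c) (s : ℤ) :
    T.BoardCycle m (fun i => c (i + s)) where
  four_le := hc.four_le
  mem i := hc.mem _
  period i := by
    rw [show i + (m : ℤ) + s = i + s + m by ring]
    exact hc.period _
  ne i j hij hji := hc.ne _ _ (by omega) (by omega)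
  adj i := by
    have := hc.adj (i + s)
    rwa [show i + s + 1 = i + 1 + s by ring] at this

theorem BoardCycle.reverse {m : ℕ} {c : ℤ → H.V} (hc : T.BoardCycle m c) :
    T.BoardCycle m (fun i => c (-i)) where
  four_le := hc.four_le
  mem i := hc.mem _
  period i := by
    rw [← hc.period (-(i + m))]
    congr 1
    ring
  ne i j hij hji := (hc.ne _ _ (by omega) (by omega)).symm
  adj i := by
    have := hc.adj (-(i + 1))
    rw [show -(i + 1) + 1 = -i by ring] at this
    exact this.symm

theorem Chordless.shift {c : ℤ → H.V} {k : ℤ} (s : ℤ) (h : Chordless H c (k + s)) :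
    Chordless H (fun i => c (i + s)) k := by
  intro j hj
  have := h (j + s) hj
  rwa [show k + s - 1 = k - 1 + s by ring, show k + s + 1 = k + 1 + s by ring] at this

theorem Chordless.reverse {c : ℤ → H.V} {k : ℤ} (h : Chordless H c (-k)) :
    Chordless H (fun i => c (-i)) k := by
  intro j hj
  have := h (-j) hj
  rw [show -k - 1 = -(k + 1) by ring, show -k + 1 = -(k - 1) by ring] at this
  exact this.symm

theorem BoardCycle.period' {m : ℕ} {c : ℤ → H.V} (hc : T.BoardCycle m c) (i : ℤ) :
    c (i - m) = c i := by
  rw [← hc.period (i - m), sub_add_cancel]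

theorem BoardCycle.emod {m : ℕ} {c : ℤ → H.V} (hc : T.BoardCycle m c) (i : ℤ) :
    c (i % m) = c i := by
  have hnat : ∀ (n : ℕ) (i : ℤ), c (i + m * n) = c i := by
    intro n
    induction n with
    | zero => simp
    | succ n ih =>
      intro i
      rw [← ih i, ← hc.period (i + m * n)]
      congr 1
      push_cast
      ring
  rcases Int.eq_nat_or_neg (i / m) with ⟨n, hn | hn⟩
  · rw [← hnat n (i % m), ← hn, Int.emod_add_mul_ediv]
  · rw [← hnat n i]
    congr 1
    have := Int.emod_add_mul_ediv i m
    rw [hn] at this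
    linarith

theorem BoardCycle.exists_nat {m : ℕ} {c : ℤ → H.V} (hc : T.BoardCycle m c) (i : ℤ) :
    ∃ n : ℕ, n < m ∧ c i = c n := by
  have hm : (0 : ℤ) < m := by have := hc.four_le; omega
  have h1 := Int.emod_nonneg i hm.ne'
  have h2 := Int.emod_lt_of_pos i hm
  refine ⟨(i % m).toNat, by omega, ?_⟩
  rw [Int.toNat_of_nonneg h1, hc.emod]

/-- Moving the uncolored vertex `n` steps along the cycle. -/
theorem BoardCycle.forward {m : ℕ} {c : ℤ → H.V} (hc : T.BoardCycle m c) {i : ℤ}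
    {φ : H.V → C} (h : T.conf (c i) φ) (n : ℕ) (hn : n < m) :
    ∃ ψ, T.conf (c (i + n)) ψ ∧ (∀ t : ℕ, t < n → ψ (c (i + t)) = φ (c (i + t + 1))) ∧
      ∀ z, (∀ t : ℕ, t < n → z ≠ c (i + t)) → ψ z = φ z := by
  induction n with
  | zero => exact ⟨φ, by simpa using h, fun t ht => by omega, fun _ _ => rfl⟩
  | succ n ih =>
    obtain ⟨ψ, h1, h2, h3⟩ := ih (by omega)
    obtain ⟨χ, h4, h5, h6⟩ := T.move h1 (hc.mem (i + n + 1)) (hc.adj _)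
    refine ⟨χ, ?_, fun t ht => ?_, fun z hz => ?_⟩
    · push_cast
      rwa [← add_assoc]
    · rcases Nat.lt_succ_iff_lt_or_eq.1 ht with ht | rfl
      · rw [h6 _ (hc.ne _ _ (by omega) (by omega)), h2 t ht]
      · rw [h5]
        refine h3 _ fun t' ht' => (hc.ne _ _ (by omega) (by omega)).symm
    · rw [h6 _ (hz n (by omega)), h3 _ fun t ht => hz t (by omega)]

theorem BoardCycle.backward {m : ℕ} {c : ℤ → H.V} (hc : T.BoardCycle m c) {i : ℤ}
    {φ : H.V → C} (h : T.conf (c i) φ) (n : ℕ) (hn : n < m) :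
    ∃ ψ, T.conf (c (i - n)) ψ ∧ (∀ t : ℕ, t < n → ψ (c (i - t)) = φ (c (i - t - 1))) ∧
      ∀ z, (∀ t : ℕ, t < n → z ≠ c (i - t)) → ψ z = φ z := by
  have h' : T.conf ((fun i => c (-i)) (-i)) φ := by simpa using h
  obtain ⟨ψ, h1, h2, h3⟩ := hc.reverse.forward h' n hn
  refine ⟨ψ, ?_, fun t ht => ?_, fun z hz => h3 z fun t ht => ?_⟩
  · rwa [show i - n = -(-i + n) by ring]
  · rw [show i - t - 1 = -(-i + t + 1) by ring, show i - t = -(-i + t) by ring]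
    exact h2 t ht
  · rw [show -(-i + (t : ℤ)) = i - t by ring]
    exact hz t ht

/-- Every edge that meets the board twice is a pair of vertices of the board. -/
def PairsOnly (T : TokenGame H C) : Prop :=
  ∀ e, ∀ a ∈ T.board, ∀ b ∈ T.board, a ≠ b → a ∈ H.inc e → b ∈ H.inc e → H.inc e = {a, b}

/-- Comparing the two ways to move the uncolored vertex from `c 0` to a chordless `c k`. -/
theorem BoardCycle.color_eq_of_chordless {m : ℕ} {c : ℤ → H.V} (hc : T.BoardCycle m c)
    (hpair : T.PairsOnly) {φ : H.V → C} (h : T.conf (c 0) φ) {k : ℕ} (hk : 1 ≤ k)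
    (hkm : k + 2 ≤ m) (hch : Chordless H c k) :
    φ (c (k + 1)) = if k = 1 then φ (c (-1)) else φ (c (k - 1)) := by
  obtain ⟨ψ, h1, h2, h3⟩ := hc.forward h k (by omega)
  obtain ⟨χ, h4, h5, h6⟩ := hc.backward h (m - k) (by omega)
  rw [zero_add] at h1
  have hk' : (0 : ℤ) - ((m - k : ℕ) : ℤ) = k - m := by
    rw [Nat.cast_sub (by omega)]
    ring
  rw [hk', hc.period'] at h4
  have hadj := hc.adj (k - 1)
  rw [sub_add_cancel] at hadj
  have e1 : ψ (c (k - 1)) = φ (c k) := by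
    have := h2 (k - 1) (by omega)
    rw [Nat.cast_sub hk] at this
    simpa using this
  have e2 : ψ (c (k + 1)) = φ (c (k + 1)) :=
    h3 _ fun t ht => (hc.ne _ _ (by omega) (by omega)).symm
  have e3 : χ (c (k + 1)) = φ (c k) := by
    have := h5 (m - k - 1) (by omega)
    rw [Nat.cast_sub (by omega), Nat.cast_sub (by omega)] at this
    rw [← hc.period' (k + 1), ← hc.period' k]
    convert this using 3 <;> push_cast <;> ring
  -- For k = 1 this vertex is the starting point `c 0`, which the backward walk recolors with the
  -- color of `c (-1)`.
  have e4 : χ (c (k - 1)) = if k = 1 then φ (c (-1)) else φ (c (k - 1)) := by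
    split_ifs with hk1
    · subst hk1
      have := h5 0 (by omega)
      simpa using this
    · refine h6 _ fun t ht => ?_
      rw [← hc.period (0 - t)]
      exact hc.ne _ _ (by omega) (by omega)
  rw [← e2, ← e4]
  refine eq_of_exchange (x := c (k - 1)) (y := c (k + 1)) hpair h1 h4 (hc.mem _) (hc.mem _)
    hadj.symm (hc.adj _) ?_ (e1.trans e3.symm)
  intro w hw hkw hw1 hw2
  have hout : ∀ j, w ≠ c j := by
    rintro j rfl
    exact (hch j hkw).elim hw1 hw2
  rw [h3 w fun t _ => hout _, h6 w fun t _ => hout _]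

theorem BoardCycle.color_eq_of_chordless_of_two_le {m : ℕ} {c : ℤ → H.V}
    (hc : T.BoardCycle m c) (hpair : T.PairsOnly) {φ : H.V → C} (h : T.conf (c 0) φ) {k : ℕ}
    (hk : 2 ≤ k) (hkm : k + 2 ≤ m) (hch : Chordless H c k) : φ (c (k + 1)) = φ (c (k - 1)) := by
  rw [hc.color_eq_of_chordless hpair h (by omega) hkm hch, if_neg (by omega)]

theorem BoardCycle.color_two_eq {m : ℕ} {c : ℤ → H.V}
    (hc : T.BoardCycle m c) (hpair : T.PairsOnly) {φ : H.V → C} (h : T.conf (c 0) φ)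
    (hch : Chordless H c 1) : φ (c 2) = φ (c (-1)) := by
  have := hc.color_eq_of_chordless hpair h le_rfl (by have := hc.four_le; omega)
    (by simpa using hch)
  simpa using this

theorem BoardCycle.color_neg_two_eq {m : ℕ} {c : ℤ → H.V}
    (hc : T.BoardCycle m c) (hpair : T.PairsOnly) {φ : H.V → C} (h : T.conf (c 0) φ)
    (hch : Chordless H c (-1)) : φ (c (-2)) = φ (c 1) := by
  have := hc.reverse.color_two_eq (φ := φ) hpair (by simpa using h) hch.reverse
  simpa using this

/-- With the uncolored vertex at `c 1`, a chordless `c (-1)` forces equal colors on its two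
neighbors. -/
theorem BoardCycle.color_neg_two_eq_zero {m : ℕ} {c : ℤ → H.V}
    (hc : T.BoardCycle m c) (hpair : T.PairsOnly) {φ : H.V → C} (h : T.conf (c 1) φ)
    (hch : Chordless H c (-1)) : φ (c (-2)) = φ (c 0) := by
  have hm := hc.four_le
  have hch' : Chordless H (fun i => c (i + 1)) ((m - 2 : ℕ) : ℤ) := by
    refine Chordless.shift 1 ?_
    intro j hj
    rw [Nat.cast_sub (by omega)] at hj ⊢
    have e1 : c ((m : ℤ) - (2 : ℕ) + 1) = c (-1) := by
      rw [← hc.period (-1)]; congr 1; push_cast; ring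
    have e2 : c ((m : ℤ) - (2 : ℕ) + 1 - 1) = c (-1 - 1) := by
      rw [← hc.period (-1 - 1)]; congr 1; push_cast; ring
    have e3 : c ((m : ℤ) - (2 : ℕ) + 1 + 1) = c (-1 + 1) := by
      rw [← hc.period (-1 + 1)]; congr 1; push_cast; ring
    rw [e1] at hj
    rw [e2, e3]
    exact hch j hj
  have := (hc.shift 1).color_eq_of_chordless_of_two_le (φ := φ) hpair (k := m - 2)
    (by simpa using h) (by omega) (by omega) hch'
  rw [Nat.cast_sub (by omega)] at this
  have e1 : c ((m : ℤ) - (2 : ℕ) + 1 + 1) = c 0 := by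
    rw [← hc.period 0]; congr 1; push_cast; ring
  have e2 : c ((m : ℤ) - (2 : ℕ) - 1 + 1) = c (-2) := by
    rw [← hc.period (-2)]; congr 1; push_cast; ring
  rw [e1, e2] at this
  exact this.symm

/-- If the rest of a cycle has one color `a` while its vertex `c 0` is uncolored, then all neighbors
of `c 0` have color `a`. -/
theorem BoardCycle.monoAt {m : ℕ} {c : ℤ → H.V} (hc : T.BoardCycle m c)
    (hB : H.twoSection.BiconnectedOn T.board) (hpair : T.PairsOnly) {φ : H.V → C}
    (h : T.conf (c 0) φ) {a : C} (ha : ∀ i, c i ≠ c 0 → φ (c i) = a)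
    (hch : Chordless H c (-1)) : T.MonoAt a (c 0) := by
  have hm := hc.four_le
  refine monoAt_of_conf h fun w hw h0w => ?_
  by_cases hwc : ∃ i, w = c i
  · obtain ⟨i, rfl⟩ := hwc
    exact ha i h0w.1.symm
  -- Leave the cycle through w, return to it at `c n`, and walk back to `c 1`. Then `c 0` carries
  -- the old color of w and `c (-2)` has color a; the chordless `c (-1)` between them makes these
  -- equal.
  obtain ⟨ψ, h1, h2, h3⟩ := T.move h hw h0w
  have h01 : c 0 ≠ c 1 := hc.ne _ _ (by omega) (by omega)
  obtain ⟨y, ⟨⟨j, rfl⟩, hjS⟩, hj⟩ := T.exists_return (D := Set.range c) (hB.2 _ (hc.mem 0))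
    Set.sdiff_subset (t := w) ⟨hw, h0w.1.symm⟩ ⟨c 1, ⟨1, rfl⟩, hc.mem 1, h01.symm⟩
  obtain ⟨χ, h4, h5, h6⟩ := hj ψ h1
  obtain ⟨n, hn, hjn⟩ := hc.exists_nat j
  rw [hjn] at h4 h6 hjS
  have hn0 : 1 ≤ n := by
    rcases Nat.eq_zero_or_pos n with rfl | h
    · exact (hjS.2 rfl).elim
    · exact h
  have hχ : ∀ s : ℕ, 1 ≤ s → s < m → s ≠ n → χ (c s) = a := by
    intro s hs hsm hsn
    have hs0 : c s ≠ c 0 := (hc.ne _ _ (by omega) (by omega)).symm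
    have hsn' : c s ≠ c n := by
      rcases lt_or_gt_of_ne hsn with hlt | hlt
      · exact hc.ne _ _ (by omega) (by omega)
      · exact (hc.ne _ _ (by omega) (by omega)).symm
    rw [h6 _ ⟨s, rfl⟩ hsn', h3 _ hs0, ha _ hs0]
  have hχ0 : χ (c 0) = φ w := by rw [h5 _ fun hh => hh.2 rfl, h2]
  obtain ⟨ω, h7, h8, h9⟩ := hc.backward h4 (n - 1) (by omega)
  rw [Nat.cast_sub hn0, Nat.cast_one, sub_sub_cancel] at h7
  have hω0 : ω (c 0) = φ w := by
    rw [h9 _ fun t ht => hc.ne _ _ (by omega) (by omega), hχ0]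
  have hω : ω (c ((m - 2 : ℕ) : ℤ)) = a := by
    by_cases hlt : n < m - 2
    · rw [h9 _ fun t ht => (hc.ne _ _ (by omega) (by omega)).symm]
      exact hχ _ (by omega) (by omega) (by omega)
    -- Here the walk back passes `c (m - 2)`, which receives the color of `c (m - 3)`, again a.
    · have := h8 (n - (m - 2)) (by omega)
      rw [show (n : ℤ) - ((n - (m - 2) : ℕ) : ℤ) = ((m - 2 : ℕ) : ℤ) by omega,
        show ((m - 2 : ℕ) : ℤ) - 1 = ((m - 3 : ℕ) : ℤ) by omega] at this
      rw [this]
      exact hχ _ (by omega) (by omega) (by omega)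
  have := hc.color_neg_two_eq_zero hpair h7 hch
  rw [hω0, ← hc.period (-2), show (-2 : ℤ) + m = ((m - 2 : ℕ) : ℤ) by omega, hω] at this
  exact this.symm

/-- A cycle of length four with at most one chord forces a single color. -/
theorem BoardCycle.exists_monoAt_of_four {c : ℤ → H.V} (hc : T.BoardCycle 4 c)
    (hB : H.twoSection.BiconnectedOn T.board) (hpair : T.PairsOnly) {φ : H.V → C}
    (h : T.conf (c 0) φ) (hch : Chordless H c 1) (hch' : Chordless H c (-1)) :
    ∃ a, T.MonoAt a (c 0) := by
  have e1 := hc.color_two_eq hpair h hch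
  have e2 := hc.color_neg_two_eq hpair h hch'
  -- In length four these are one vertex, so the two relations link all three colored vertices.
  have e3 : c (-2) = c 2 := by rw [← hc.period (-2)]; norm_num
  have e4 : c (-1) = c 3 := by rw [← hc.period (-1)]; norm_num
  rw [e3] at e2
  rw [e4] at e1
  refine ⟨φ (c 2), hc.monoAt hB hpair h (fun i hi => ?_) hch'⟩
  obtain ⟨n, hn, hin⟩ := hc.exists_nat i
  rw [hin] at hi ⊢
  have : n ≠ 0 := by
    rintro rfl
    exact hi rfl
  obtain rfl | rfl | rfl : n = 1 ∨ n = 2 ∨ n = 3 := by omega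
  · exact e2.symm
  · rfl
  · exact e1.symm

theorem BoardCycle.monoAt_of_eq {m : ℕ} {c : ℤ → H.V} (hc : T.BoardCycle m c)
    (hB : H.twoSection.BiconnectedOn T.board) (hpair : T.PairsOnly)
    (hch : ∀ k, Chordless H c k) {φ : H.V → C} (h : T.conf (c 0) φ)
    (heq : φ (c 1) = φ (c (-1))) : T.MonoAt (φ (c 1)) (c 0) := by
  -- Chordless vertices make the colors repeat with period two; the two starting values agree
  -- because `c 2` has the color of `c (-1)`.
  have key : ∀ n : ℕ, 1 ≤ n → n < m → φ (c n) = φ (c 1) := by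
    intro n
    induction n using Nat.strong_induction_on with
    | _ n ih =>
      intro hn hnm
      obtain rfl | rfl | hn3 : n = 1 ∨ n = 2 ∨ 3 ≤ n := by omega
      · simp
      · exact (hc.color_two_eq hpair h (hch 1)).trans heq.symm
      · have := hc.color_eq_of_chordless_of_two_le hpair h (k := n - 1) (by omega) (by omega)
          (hch _)
        rw [show ((n - 1 : ℕ) : ℤ) + 1 = n by omega,
          show ((n - 1 : ℕ) : ℤ) - 1 = ((n - 2 : ℕ) : ℤ) by omega] at this
        rw [this]
        exact ih _ (by omega) (by omega) (by omega)
  refine hc.monoAt hB hpair h (fun i hi => ?_) (hch _)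
  obtain ⟨n, hn, hin⟩ := hc.exists_nat i
  rw [hin] at hi ⊢
  refine key n ?_ hn
  rcases Nat.eq_zero_or_pos n with rfl | h
  · exact (hi rfl).elim
  · exact h

/-- A detour through w acts on the cycle like the step from `c 0` to `c 1`, except that `c 0`
receives the color of w. Comparing it with the relations along the cycle shows that w always agrees
with `c 1` when `c 0` is uncolored. Reaching `c 0` from `c 1` in both directions then shows that `c
0` and `c 2` agree when `c 1` is uncolored. -/
theorem BoardCycle.exists_monoAt_of_return {m : ℕ} {c : ℤ → H.V} (hc : T.BoardCycle m c)
    (hB : H.twoSection.BiconnectedOn T.board) (hpair : T.PairsOnly)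
    (hch : ∀ k, Chordless H c k) {φ : H.V → C} (h : T.conf (c 0) φ) {w : H.V}
    (hwc : ∀ i, w ≠ c i)
    (hret : ∀ φ, T.conf (c 0) φ → ∃ ψ, T.conf (c 1) ψ ∧ ψ (c 0) = φ w ∧
      ∀ i, c i ≠ c 0 → c i ≠ c 1 → ψ (c i) = φ (c i)) :
    ∃ a, T.MonoAt a (c 1) := by
  have hm := hc.four_le
  have hw : ∀ φ, T.conf (c 0) φ → φ w = φ (c 1) := by
    intro φ hφ
    obtain ⟨ψ, h1, h2, h3⟩ := hret φ hφ
    have e1 := hc.color_neg_two_eq_zero hpair h1 (hch _)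
    have e2 := hc.color_neg_two_eq hpair hφ (hch _)
    rw [h3 _ (hc.ne _ _ (by omega) (by omega)) (hc.ne _ _ (by omega) (by omega)), h2] at e1
    rw [← e1, e2]
  have hadj := hc.adj 0
  rw [zero_add] at hadj
  obtain ⟨χ, hχ, -⟩ := T.move h (hc.mem 1) hadj
  have e1 : χ w = χ (c 0) := by
    obtain ⟨ψ, h1, h2, h3⟩ := T.move hχ (hc.mem 0) hadj.symm
    rw [← h2, ← hw ψ h1, h3 w (hwc 1)]
  have e2 : χ w = χ (c 2) := by
    obtain ⟨ψ, h1, h2, h3⟩ := hc.forward hχ (m - 1) (by omega)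
    rw [show (1 : ℤ) + ((m - 1 : ℕ) : ℤ) = 0 + m by omega, hc.period] at h1
    have := h2 0 (by omega)
    rw [← h3 w fun t _ => hwc _, hw ψ h1]
    simpa using this
  refine ⟨χ (c 2), ?_⟩
  have := (hc.shift 1).monoAt_of_eq hB hpair (fun k => (hch _).shift) (φ := χ)
    (by simpa using hχ) (by simpa using e2.symm.trans e1)
  simpa using this

/-- An induced cycle that is not the whole board forces a single color. -/
theorem BoardCycle.exists_monoAt {m : ℕ} {c : ℤ → H.V} (hc : T.BoardCycle m c)
    (hB : H.twoSection.BiconnectedOn T.board) (hpair : T.PairsOnly)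
    (hch : ∀ k, Chordless H c k) {t : H.V} {φ : H.V → C} (h : T.conf t φ)
    (hne : Set.range c ≠ T.board) : ∃ a, ∃ v ∈ T.board, T.MonoAt a v := by
  have hm := hc.four_le
  have hcB : Set.range c ⊆ T.board := Set.range_subset_iff.2 hc.mem
  obtain ⟨i, w, hw, hwc, hiw⟩ : ∃ i, ∃ w ∈ T.board, (∀ j, w ≠ c j) ∧
      H.twoSection.Adj (c i) w := by
    by_contra! hcon
    refine hne (hB.1 _ hcB ⟨c 0, 0, rfl⟩ ?_)
    rintro _ ⟨i, rfl⟩ b hb hib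
    by_contra hbc
    exact hcon i b hb (fun j hj => hbc ⟨j, hj.symm⟩) hib
  wlog hi : i = 0 generalizing c i
  · refine this (hc.shift i) (fun k => (hch _).shift) ?_ ?_ 0 (fun j => hwc _) (by simpa using hiw)
      rfl
    · rintro hh
      refine hne (hh ▸ Set.Subset.antisymm ?_ ?_)
      · rintro _ ⟨j, rfl⟩
        exact ⟨j - i, by simp⟩
      · rintro _ ⟨j, rfl⟩
        exact ⟨j + i, rfl⟩
    · rintro _ ⟨j, rfl⟩
      exact hc.mem _
  subst hi
  obtain ⟨φ₀, hφ₀, -⟩ := T.exists_conf hB.1 le_rfl h (T.mem_board h) (hc.mem 0)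
  have h01 : c 0 ≠ c 1 := hc.ne _ _ (by omega) (by omega)
  obtain ⟨y, ⟨⟨j, rfl⟩, hjS⟩, hj⟩ := T.exists_return (D := Set.range c) (hB.2 _ (hc.mem 0))
    Set.sdiff_subset (t := w) ⟨hw, hiw.1.symm⟩ ⟨c 1, ⟨1, rfl⟩, hc.mem 1, h01.symm⟩
  obtain ⟨n, hn, hjn⟩ := hc.exists_nat j
  rw [hjn] at hj hjS
  have hret : ∀ φ, T.conf (c 0) φ → ∃ ψ, T.conf (c n) ψ ∧ ψ (c 0) = φ w ∧
      ∀ i, c i ≠ c 0 → c i ≠ c n → ψ (c i) = φ (c i) := by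
    intro φ hφ
    obtain ⟨ψ, h1, h2, h3⟩ := T.move hφ hw hiw
    obtain ⟨χ, h4, h5, h6⟩ := hj ψ h1
    refine ⟨χ, h4, by rw [h5 _ fun hh => hh.2 rfl, h2], fun i hi hin => ?_⟩
    rw [h6 _ ⟨i, rfl⟩ hin, h3 _ hi]
  have hn0 : n ≠ 0 := by
    rintro rfl
    exact hjS.2 rfl
  obtain hn1 | hn1 | ⟨hn1, hn2⟩ : n = 1 ∨ n = m - 1 ∨ 2 ≤ n ∧ n + 2 ≤ m := by omega
  · subst hn1
    obtain ⟨a, ha⟩ := hc.exists_monoAt_of_return hB hpair hch hφ₀ hwc (by simpa using hret)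
    exact ⟨a, _, hc.mem _, ha⟩
  · have e1 : c n = c (-1) := by
      rw [← hc.period (-1)]
      congr 1
      omega
    rw [e1] at hret
    obtain ⟨a, ha⟩ := hc.reverse.exists_monoAt_of_return hB hpair (fun k => (hch _).reverse)
      (φ := φ₀) (w := w) (by simpa using hφ₀) (fun i => hwc _) (by
        simp only [neg_zero]
        intro φ hφ
        obtain ⟨ψ, h1, h2, h3⟩ := hret φ hφ
        exact ⟨ψ, h1, h2, fun i => h3 (-i)⟩)
    exact ⟨a, _, hc.mem _, ha⟩
  -- The return point is not next to `c 0`. Seen from there, the chordless `c 0` has equally colored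
  -- neighbors `c 1` and `c (-1)`, and the detour changed neither color.
  · obtain ⟨ψ, h1, -, h3⟩ := hret φ₀ hφ₀
    have := (hc.shift n).color_eq_of_chordless_of_two_le (φ := ψ) hpair (k := m - n)
      (by simpa using h1) (by omega) (by omega) (hch _).shift
    have e1 : c (((m - n : ℕ) : ℤ) + 1 + n) = c 1 := by
      rw [← hc.period 1]
      congr 1
      omega
    have e2 : c (((m - n : ℕ) : ℤ) - 1 + n) = c (-1) := by
      rw [← hc.period (-1)]
      congr 1
      omega
    rw [e1, e2, h3 1 h01.symm (hc.ne _ _ (by omega) (by omega)),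
      h3 (-1) (hc.ne _ _ (by omega) (by omega)) (hc.ne _ _ (by omega) (by omega))] at this
    exact ⟨_, _, hc.mem 0, hc.monoAt_of_eq hB hpair hch hφ₀ this⟩

end TokenGame

end MultiHypergraph

/-! ### Induced paths -/

/-- `p 0, …, p n` is an induced path of `G` inside `S`. -/
structure SimpleGraph.IsInducedPathOn {V : Type*} (G : SimpleGraph V) (S : Set V) (n : ℕ)
    (p : ℕ → V) : Prop where
  mem : ∀ i ≤ n, p i ∈ S
  adj : ∀ i < n, G.Adj (p i) (p (i + 1))
  ne : ∀ i j, i < j → j ≤ n → p i ≠ p j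
  eq_of_adj : ∀ i j, i < j → j ≤ n → G.Adj (p i) (p j) → j = i + 1

theorem SimpleGraph.ConnectedOn.exists_isInducedPathOn {V : Type*} {G : SimpleGraph V} {S : Set V}
    (hS : G.ConnectedOn S) {y z : V} (hy : y ∈ S) (hz : z ∈ S) :
    ∃ n p, G.IsInducedPathOn S n p ∧ p 0 = y ∧ p n = z := by
  classical
  let Q : V → ℕ → Prop := fun z n => ∃ p : ℕ → V, (∀ i ≤ n, p i ∈ S) ∧
    (∀ i < n, G.Adj (p i) (p (i + 1))) ∧ p 0 = y ∧ p n = z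
  have hex : ∃ n, Q z n := by
    have := hS {z ∈ S | ∃ n, Q z n} (Set.sep_subset _ _)
      ⟨y, hy, 0, fun _ => y, fun _ _ => hy, fun i hi => absurd hi (Nat.not_lt_zero i), rfl, rfl⟩ (by
        rintro a ⟨ha, n, p, h1, h2, h3, h4⟩ b hb hab
        refine ⟨hb, n + 1, fun t => if t ≤ n then p t else b, fun i hi => ?_, fun i hi => ?_, ?_,
          ?_⟩
        · dsimp only
          split_ifs with h
          · exact h1 i h
          · exact hb
        · dsimp only
          rw [if_pos (by omega : i ≤ n)]
          split_ifs with h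
          · exact h2 i (by omega)
          · rw [show i = n by omega, h4]
            exact hab
        · simpa using h3
        · simp)
    rw [← this] at hz
    exact hz.2
  obtain ⟨p, h1, h2, h3, h4⟩ := Nat.find_spec hex
  set n := Nat.find hex with hn
  have hmin : ∀ k < n, ¬ Q z k := fun k hk => Nat.find_min hex hk
  -- Shortcuts of a shortest walk: s = 0 is a repeated vertex, s = 1 a chord. Either removes j - i -
  -- s steps.
  have hshort : ∀ i j s, i < j → j ≤ n → i + s < j →
      (s = 0 ∧ p i = p j ∨ s = 1 ∧ G.Adj (p i) (p j)) → False := by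
    intro i j s hij hjn hs hcase
    refine hmin (n - (j - i - s)) (by omega)
      ⟨fun t => if t ≤ i then p t else p (t + (j - i - s)), fun t ht => ?_, fun t ht => ?_, ?_, ?_⟩
    · dsimp only
      split_ifs
      · exact h1 t (by omega)
      · exact h1 _ (by omega)
    · dsimp only
      rcases lt_trichotomy t i with hti | rfl | hti
      · rw [if_pos (by omega), if_pos (by omega)]
        exact h2 t (by omega)
      · rw [if_pos le_rfl, if_neg (by omega)]
        rcases hcase with ⟨rfl, he⟩ | ⟨rfl, he⟩
        · rw [he, show t + 1 + (j - t - 0) = j + 1 by omega]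
          exact h2 j (by omega)
        · rwa [show t + 1 + (j - t - 1) = j by omega]
      · rw [if_neg (by omega), if_neg (by omega), add_right_comm]
        exact h2 _ (by omega)
    · simpa using h3
    · dsimp only
      split_ifs with h
      · have : j = n := by omega
        rcases hcase with ⟨rfl, he⟩ | ⟨rfl, he⟩
        · rw [show n - (j - i - 0) = i by omega, he, this, h4]
        · omega
      · rw [show n - (j - i - s) + (j - i - s) = n by omega, h4]
  refine ⟨n, p, ⟨h1, h2, fun i j hij hjn he => ?_, fun i j hij hjn he => ?_⟩, h3, h4⟩
  · exact hshort i j 0 hij hjn (by omega) (Or.inl ⟨rfl, he⟩)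
  · by_contra hne
    exact hshort i j 1 hij hjn (by omega) (Or.inr ⟨rfl, he⟩)

theorem SimpleGraph.IsInducedPathOn.drop {V : Type*} {G : SimpleGraph V} {S : Set V} {n : ℕ}
    {p : ℕ → V} (h : G.IsInducedPathOn S n p) {a l : ℕ} (hl : a + l ≤ n) :
    G.IsInducedPathOn S l (fun t => p (a + t)) where
  mem i hi := h.mem _ (by omega)
  adj i hi := h.adj _ (by omega)
  ne i j hij hj := h.ne _ _ (by omega) (by omega)
  eq_of_adj i j hij hj hadj := by
    have := h.eq_of_adj _ _ (by omega) (by omega) hadj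
    omega

/-- Otherwise the closed neighborhood of y in S is closed under adjacency, hence is all of S. -/
theorem SimpleGraph.ConnectedOn.exists_adj_adj_not_adj {V : Type*} {G : SimpleGraph V} {S : Set V}
    (hS : G.ConnectedOn S) {y v : V} (hy : y ∈ S) (hv : v ∈ S) (hyv : y ≠ v)
    (hadj : ¬ G.Adj y v) :
    ∃ x ∈ S, ∃ z ∈ S, G.Adj x y ∧ G.Adj x z ∧ z ≠ y ∧ ¬ G.Adj y z := by
  by_contra! hcon
  have := hS {w ∈ S | w = y ∨ G.Adj y w} (Set.sep_subset _ _) ⟨y, hy, Or.inl rfl⟩ (by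
    rintro a ⟨ha, rfl | hya⟩ b hb hab
    · exact ⟨hb, Or.inr hab⟩
    · refine ⟨hb, ?_⟩
      by_cases hby : b = y
      · exact Or.inl hby
      · exact Or.inr (hcon a ha b hb hya.symm hab hby))
  rw [← this] at hv
  exact hv.2.elim (fun h => hyv h.symm) hadj

theorem Int.add_one_emod_eq_ite {m : ℕ} (hm : 0 < m) (i : ℤ) :
    (i + 1) % m = if i % m + 1 = m then 0 else i % m + 1 := by
  have h1 := Int.emod_nonneg i (by omega : (m : ℤ) ≠ 0)
  have h2 := Int.emod_lt_of_pos i (by omega : (0 : ℤ) < m)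
  rw [← Int.emod_add_emod]
  split_ifs with h
  · rw [h, Int.emod_self]
  · exact Int.emod_eq_of_lt (by omega) (by omega)

/-! ### Induced cycles and four-cycles in a biconnected board -/

namespace MultiHypergraph

namespace TokenGame

variable {H : MultiHypergraph.{u}} {C : Type v} {T : TokenGame H C}

theorem BoardCycle.of_nat {m : ℕ} (hm : 4 ≤ m) {d : ℕ → H.V} (hmem : ∀ r < m, d r ∈ T.board)
    (hne : ∀ r s, r < s → s < m → d r ≠ d s)
    (hadj : ∀ r, r + 1 < m → H.twoSection.Adj (d r) (d (r + 1)))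
    (hlast : H.twoSection.Adj (d (m - 1)) (d 0)) :
    T.BoardCycle m (fun i => d (i % m).toNat) := by
  have h1 : ∀ i : ℤ, 0 ≤ i % m := fun i => Int.emod_nonneg i (by omega : (m : ℤ) ≠ 0)
  have h2 : ∀ i : ℤ, i % m < m := fun i => Int.emod_lt_of_pos i (by omega : (0 : ℤ) < m)
  have hne' : ∀ r s, r ≠ s → r < m → s < m → d r ≠ d s := fun r s hrs hr hs => by
    rcases lt_or_gt_of_ne hrs with h | h
    · exact hne _ _ h hs
    · exact (hne _ _ h hr).symm
  refine ⟨hm, fun i => hmem _ ?_, fun i => ?_, fun i j hij hji => hne' _ _ ?_ ?_ ?_, fun i => ?_⟩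
  · have := h1 i; have := h2 i; omega
  · simp
  · intro heq
    have h3 : i % m = j % m := by
      have := h1 i; have := h1 j; omega
    have h4 : (m : ℤ) ∣ j - i := Int.ModEq.dvd h3
    have := Int.le_of_dvd (by omega) h4
    omega
  · have := h1 i; have := h2 i; omega
  · have := h1 j; have := h2 j; omega
  · rw [Int.add_one_emod_eq_ite (by omega)]
    have := h1 i
    have := h2 i
    split_ifs with h
    · rw [show (i % m).toNat = m - 1 by omega]
      exact hlast
    · rw [show (i % m + 1).toNat = (i % m).toNat + 1 by omega]
      exact hadj _ (by omega)

theorem chordless_of_nat {m : ℕ} (hm : 0 < m) {d : ℕ → H.V} {k : ℤ}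
    (h : ∀ s < m, H.twoSection.Adj (d (k % m).toNat) (d s) → s + 1 = (k % m).toNat ∨
      s = (k % m).toNat + 1 ∨ (k % m = 0 ∧ s + 1 = m) ∨ (s = 0 ∧ k % m + 1 = m)) :
    Chordless H (fun i => d (i % m).toNat) k := by
  have h1 : ∀ i : ℤ, 0 ≤ i % m := fun i => Int.emod_nonneg i (by omega : (m : ℤ) ≠ 0)
  have h2 : ∀ i : ℤ, i % m < m := fun i => Int.emod_lt_of_pos i (by omega : (0 : ℤ) < m)
  intro j hj
  have h3 := Int.add_one_emod_eq_ite hm k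
  have h4 := Int.add_one_emod_eq_ite hm (k - 1)
  rw [sub_add_cancel] at h4
  have e1 := h1 k
  have e2 := h2 k
  have e3 := h1 j
  have e4 := h2 j
  have e5 := h1 (k - 1)
  have e6 := h2 (k - 1)
  have key : j % m = (k - 1) % m ∨ j % m = (k + 1) % m := by
    rcases h (j % m).toNat (by omega) hj with h5 | h5 | h5 | h5 <;>
      · split_ifs at h3 h4 <;> omega
  exact key.imp (fun h => by dsimp only; rw [h]) fun h => by dsimp only; rw [h]

/-- The cycle formed by an induced path and a further vertex adjacent to both of its ends. -/
theorem exists_boardCycle_of_path {S : Set H.V} (hS : S ⊆ T.board) {l : ℕ} (hl : 2 ≤ l)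
    {p : ℕ → H.V}
    (hp : H.twoSection.IsInducedPathOn S l p) {x : H.V} (hx : x ∈ T.board) (hxS : x ∉ S)
    (h0 : H.twoSection.Adj x (p 0)) (hend : H.twoSection.Adj x (p l)) :
    ∃ c, T.BoardCycle (l + 2) c ∧ Chordless H c 1 ∧ Chordless H c (-1) ∧ c 0 = x ∧
      ((∀ t, 0 < t → t < l → ¬ H.twoSection.Adj x (p t)) → ∀ k, Chordless H c k) := by
  let d : ℕ → H.V := fun r => if r = 0 then x else p (r - 1)
  have hd0 : d 0 = x := rfl
  have hd : ∀ r, 0 < r → d r = p (r - 1) := fun r hr => if_neg hr.ne'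
  have hlt : ∀ r s, 0 < r → r < s → s < l + 2 → H.twoSection.Adj (d r) (d s) → s = r + 1 := by
    intro r s hr hrs hs hadj
    rw [hd r hr, hd s (by omega)] at hadj
    have := hp.eq_of_adj _ _ (by omega) (by omega) hadj
    omega
  refine ⟨fun i => d (i % ((l + 2 : ℕ) : ℤ)).toNat, BoardCycle.of_nat (by omega) (fun r hr => ?_)
    (fun r s hrs hs => ?_) (fun r hr => ?_) ?_, chordless_of_nat (by omega) ?_,
    chordless_of_nat (by omega) ?_, ?_, fun h k => chordless_of_nat (by omega) ?_⟩
  · rcases Nat.eq_zero_or_pos r with rfl | h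
    · exact hx
    · rw [hd r h]
      exact hS (hp.mem _ (by omega))
  · rw [hd s (by omega)]
    rcases Nat.eq_zero_or_pos r with rfl | h
    · rintro hh
      exact hxS (hd0.symm.trans hh ▸ hp.mem _ (by omega))
    · rw [hd r h]
      exact hp.ne _ _ (by omega) (by omega)
  · rcases Nat.eq_zero_or_pos r with rfl | h
    · exact h0
    · rw [hd r h, hd (r + 1) (by omega)]
      have := hp.adj (r - 1) (by omega)
      rwa [show r - 1 + 1 = r + 1 - 1 by omega] at this
  · rw [hd _ (by omega)]
    exact hend.symm
  · have hm : (1 : ℤ) % ((l + 2 : ℕ) : ℤ) = 1 := Int.emod_eq_of_lt (by omega) (by omega)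
    rw [hm]
    intro s hs hadj
    rcases Nat.lt_trichotomy s 1 with h | rfl | h
    · left; simp; omega
    · exact (hadj.1 rfl).elim
    · have := hlt 1 s (by omega) h hs hadj
      right; left; simpa using this
  · have hm : (-1 : ℤ) % ((l + 2 : ℕ) : ℤ) = l + 1 := by
      rw [← Int.add_emod_right, Int.emod_eq_of_lt] <;> push_cast <;> omega
    rw [hm, show ((l : ℤ) + 1).toNat = l + 1 by omega]
    intro s hs hadj
    rcases Nat.eq_zero_or_pos s with rfl | h
    · right; right; right; constructor
      · rfl
      · push_cast; ring
    · rcases Nat.lt_trichotomy s (l + 1) with h' | rfl | h'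
      · have := hlt s (l + 1) h h' (by omega) hadj.symm
        left; omega
      · exact (hadj.1 rfl).elim
      · omega
  · simp [hd0]
  · have h1 := Int.emod_nonneg k (by omega : ((l + 2 : ℕ) : ℤ) ≠ 0)
    have h2 := Int.emod_lt_of_pos k (by omega : (0 : ℤ) < ((l + 2 : ℕ) : ℤ))
    obtain ⟨r, hr⟩ := Int.eq_ofNat_of_zero_le h1
    rw [hr, Int.toNat_natCast]
    rw [hr] at h2
    intro s hs hadj
    rcases Nat.lt_trichotomy r s with hrs | rfl | hrs
    · rcases Nat.eq_zero_or_pos r with rfl | h0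
      · rw [hd s hrs, hd0] at hadj
        by_contra! hcon
        exact h (s - 1) (by omega) (by omega) hadj
      · exact Or.inr (Or.inl (hlt r s h0 hrs hs hadj))
    · exact (hadj.1 rfl).elim
    · rcases Nat.eq_zero_or_pos s with rfl | h0
      · rw [hd r hrs, hd0] at hadj
        by_contra! hcon
        exact h (r - 1) (by omega) (by omega) hadj.symm
      · exact Or.inl (hlt s r h0 hrs (by omega) hadj.symm).symm

/-- A biconnected board forces a single color, or is complete, or is an induced cycle. -/
theorem mono_or_complete_or_cycle (hB : H.twoSection.BiconnectedOn T.board)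
    (hpair : T.PairsOnly) {t : H.V} {φ : H.V → C} (h : T.conf t φ) :
    (∃ a, ∃ v ∈ T.board, T.MonoAt a v) ∨
      (∀ x ∈ T.board, ∀ y ∈ T.board, x ≠ y → H.twoSection.Adj x y) ∨
      ∃ m c, T.BoardCycle m c ∧ (∀ k, Chordless H c k) ∧ Set.range c = T.board := by
  classical
  by_cases hcomp : ∀ x ∈ T.board, ∀ y ∈ T.board, x ≠ y → H.twoSection.Adj x y
  · exact Or.inr (Or.inl hcomp)
  push Not at hcomp
  obtain ⟨y, hy, v, hv, hyv, hadj⟩ := hcomp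
  obtain ⟨x, hx, z, hz, hxy, hxz, hzy, hyz⟩ := hB.1.exists_adj_adj_not_adj hy hv hyv hadj
  obtain ⟨n, p, hp, hp0, hpn⟩ := (hB.2 x hx).exists_isInducedPathOn (y := y) (z := z)
    ⟨hy, hxy.1.symm⟩ ⟨hz, hxz.1.symm⟩
  have hn : 2 ≤ n := by
    by_contra! hlt
    interval_cases n
    · exact hzy (hpn.symm.trans hp0)
    · have := hp.adj 0 (by omega)
      rw [hp0, zero_add, hpn] at this
      exact hyz this
  have hxS : x ∉ T.board \ {x} := fun hh => hh.2 rfl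
  -- Two consecutive neighbors of x on the path, at distance at least two along it, close up to an
  -- induced cycle.
  have hole : ∀ a l, 2 ≤ l → a + l ≤ n → H.twoSection.Adj x (p a) →
      H.twoSection.Adj x (p (a + l)) → (∀ t, 0 < t → t < l → ¬ H.twoSection.Adj x (p (a + t))) →
      (∃ a, ∃ v ∈ T.board, T.MonoAt a v) ∨
        ∃ m c, T.BoardCycle m c ∧ (∀ k, Chordless H c k) ∧ Set.range c = T.board := by
    intro a l hl hal h1 h2 h3
    obtain ⟨c, hc, -, -, -, hch⟩ := exists_boardCycle_of_path Set.sdiff_subset hl (hp.drop hal) hx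
      hxS h1 h2
    by_cases hr : Set.range c = T.board
    · exact Or.inr ⟨_, c, hc, hch h3, hr⟩
    · exact Or.inl (hc.exists_monoAt hB hpair (hch h3) h hr)
  suffices hgoal : (∃ a, ∃ v ∈ T.board, T.MonoAt a v) ∨
      ∃ m c, T.BoardCycle m c ∧ (∀ k, Chordless H c k) ∧ Set.range c = T.board from
    hgoal.imp_right Or.inr
  have hx0 : H.twoSection.Adj x (p 0) := hp0 ▸ hxy
  have hxn : H.twoSection.Adj x (p n) := hpn ▸ hxz
  have next : ∀ a, a < n → ∃ l, 0 < l ∧ a + l ≤ n ∧ H.twoSection.Adj x (p (a + l)) ∧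
      ∀ t, 0 < t → t < l → ¬ H.twoSection.Adj x (p (a + t)) := by
    intro a ha
    have hex : ∃ l, 0 < l ∧ H.twoSection.Adj x (p (a + l)) :=
      ⟨n - a, by omega, by rwa [show a + (n - a) = n by omega]⟩
    refine ⟨Nat.find hex, (Nat.find_spec hex).1, ?_, (Nat.find_spec hex).2, fun t ht htl hadj =>
      Nat.find_min hex htl ⟨ht, hadj⟩⟩
    have := Nat.find_min' hex (m := n - a) ⟨by omega, by rwa [show a + (n - a) = n by omega]⟩
    omega
  obtain ⟨l, hl0, hln, hl, hmin⟩ := next 0 (by omega)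
  by_cases hl2 : 2 ≤ l
  · exact hole 0 l hl2 hln hx0 hl hmin
  obtain rfl : l = 1 := by omega
  obtain ⟨l, hl0', hln', hl', hmin'⟩ := next 1 (by omega)
  by_cases hl2' : 2 ≤ l
  · exact hole 1 l hl2' hln' (by simpa using hl) hl' hmin'
  obtain rfl : l = 1 := by omega
  -- Now x is adjacent to `p 0`, `p 1` and `p 2`: a four-cycle whose only chord joins x to `p 1`.
  obtain ⟨c, hc, hc1, hc2, hc0, -⟩ := exists_boardCycle_of_path Set.sdiff_subset le_rfl
    (hp.drop (a := 0) (l := 2) (by omega)) hx hxS (by simpa using hx0) (by simpa using hl')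
  obtain ⟨ψ, hψ, -⟩ := T.exists_conf hB.1 le_rfl h (T.mem_board h) (hc.mem 0)
  obtain ⟨a, ha⟩ := hc.exists_monoAt_of_four hB hpair hψ hc1 hc2
  exact Or.inl ⟨a, _, hc.mem 0, ha⟩

end TokenGame

end MultiHypergraph

/-! ### Degrees in the three types of boards -/

namespace MultiHypergraph

variable {H : MultiHypergraph.{u}}

theorem degreeOn_le_degree (S : Set H.V) (v : H.V) : H.degreeOn S v ≤ H.degree v :=
  Set.ncard_le_ncard (fun _ he => he.1) (Set.toFinite _)

namespace TokenGame

variable {C : Type v} {T : TokenGame H C}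

/-- On such a board H is an ordinary simple graph, so edges at v and neighbors of v correspond. -/
theorem PairsOnly.degreeOn_eq (hpair : T.PairsOnly)
    (hsimple : ∀ e e', H.inc e ⊆ T.board → H.inc e = H.inc e' → e = e') {v : H.V}
    (hv : v ∈ T.board) :
    H.degreeOn T.board v = {w ∈ T.board | H.twoSection.Adj v w}.ncard := by
  symm
  have hch : ∀ (w : H.V) (hw : w ∈ {w ∈ T.board | H.twoSection.Adj v w}),
      H.inc hw.2.2.choose = {v, w} := fun w hw =>
    hpair _ v hv w hw.1 hw.2.1 hw.2.2.choose_spec.1 hw.2.2.choose_spec.2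
  refine Set.ncard_congr (fun w hw => hw.2.2.choose) (fun w hw => ?_) (fun w w' hw hw' h => ?_)
    (fun e he => ?_)
  · exact ⟨hw.2.2.choose_spec.1, w, hw.1, hw.2.1.symm, hw.2.2.choose_spec.2⟩
  · have h1 := hch w hw
    rw [h, hch w' hw'] at h1
    have h2 : w ∈ ({v, w'} : Set H.V) := h1 ▸ Or.inr rfl
    exact h2.resolve_left hw.2.1.symm
  · obtain ⟨hve, w, hw, hwv, hwe⟩ := he
    have hw' : w ∈ {w ∈ T.board | H.twoSection.Adj v w} := ⟨hw, hwv.symm, e, hve, hwe⟩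
    refine ⟨w, hw', ?_⟩
    refine hsimple _ _ ?_ ((hch w hw').trans (hpair e v hv w hw hwv.symm hve hwe).symm)
    rw [hch w hw']
    exact Set.insert_subset hv (Set.singleton_subset_iff.2 hw)

/-- The local structure of the board: either all degrees on the board are at most `T.mult`, or the
board is a complete graph, or it is 2-regular with at least four vertices. -/
theorem degreeOn_le_or_complete_or_cycle (hB : H.twoSection.BiconnectedOn T.board)
    (hsimple : ∀ e e', H.inc e ⊆ T.board → H.inc e = H.inc e' → e = e')
    {t : H.V} {φ : H.V → C} (h : T.conf t φ) :
    (∀ v ∈ T.board, H.degreeOn T.board v ≤ T.mult) ∨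
      (T.PairsOnly ∧ (∀ x ∈ T.board, ∀ y ∈ T.board, x ≠ y → H.twoSection.Adj x y) ∧
        ∀ v ∈ T.board, H.degreeOn T.board v + 1 = T.board.ncard) ∨
      ((∀ v ∈ T.board, H.degreeOn T.board v = 2) ∧ 3 ≤ T.board.ncard) := by
  by_cases hmono : ∃ a, ∃ v ∈ T.board, T.MonoAt a v
  · obtain ⟨a, v, hv, ha⟩ := hmono
    exact Or.inl fun w hw => ha.degreeOn_le_of_mem hB hv h hw
  refine Or.inr ?_
  have hpair : T.PairsOnly := by
    intro e a ha b hb hab hae hbe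
    by_contra hne
    obtain ⟨w, hwe, hw⟩ : ∃ w ∈ H.inc e, w ∉ ({a, b} : Set H.V) := by
      by_contra! hcon
      exact hne (Set.Subset.antisymm hcon
        (Set.insert_subset hae (Set.singleton_subset_iff.2 hbe)))
    simp only [Set.mem_insert_iff, Set.mem_singleton_iff, not_or] at hw
    obtain ⟨ψ, hψ, -⟩ := T.exists_conf hB.1 le_rfl h (T.mem_board h) ha
    exact hmono ⟨_, a, ha, exists_monoAt_of_edge hB ha hb hae hbe hwe hab.symm hw.1 hw.2 hψ⟩
  rcases mono_or_complete_or_cycle hB hpair h with h1 | h1 | ⟨m, c, hc, hch, hr⟩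
  · exact (hmono h1).elim
  · refine Or.inl ⟨hpair, h1, fun v hv => ?_⟩
    rw [hpair.degreeOn_eq hsimple hv]
    have : {w ∈ T.board | H.twoSection.Adj v w} = T.board \ {v} := by
      ext w
      exact ⟨fun hw => ⟨hw.1, hw.2.1.symm⟩, fun hw => ⟨hw.1, h1 v hv w hw.1 fun h => hw.2 h.symm⟩⟩
    rw [this, Set.ncard_sdiff_singleton_add_one hv (Set.toFinite _)]
  · refine Or.inr ⟨fun v hv => ?_, ?_⟩
    · rw [hpair.degreeOn_eq hsimple hv]
      obtain ⟨k, rfl⟩ := hr ▸ hv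
      have : {w ∈ T.board | H.twoSection.Adj (c k) w} = {c (k - 1), c (k + 1)} := by
        ext w
        constructor
        · rintro ⟨hw, hkw⟩
          obtain ⟨j, rfl⟩ := hr ▸ hw
          exact hch k j hkw
        · have hadj := hc.adj (k - 1)
          rw [sub_add_cancel] at hadj
          rintro (rfl | rfl)
          · exact ⟨hc.mem _, hadj.symm⟩
          · exact ⟨hc.mem _, hc.adj k⟩
      have hm := hc.four_le
      rw [this, Set.ncard_pair (hc.ne _ _ (by omega) (by omega))]
    · have hm := hc.four_le
      have : ({c 0, c 1, c 2} : Set H.V).ncard = 3 := Set.ncard_eq_three.2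
        ⟨_, _, _, hc.ne _ _ (by omega) (by omega), hc.ne _ _ (by omega) (by omega),
          hc.ne _ _ (by omega) (by omega), rfl⟩
      rw [← this]
      refine Set.ncard_le_ncard ?_ (Set.toFinite _)
      rintro _ (rfl | rfl | rfl) <;> exact hc.mem _

end TokenGame

theorem nonempty_iso_complete {n : ℕ} (hn : H.order = n)
    (hinj : ∀ e e', H.inc e = H.inc e' → e = e') (htwo : ∀ e, (H.inc e).ncard = 2)
    (hadj : ∀ x y, x ≠ y → ∃ e, H.inc e = {x, y}) :
    Nonempty (H.Iso (complete n)) := by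
  have hcard : Nat.card H.V = Nat.card (ULift.{u} (Fin n)) := by
    rw [Nat.card_eq_fintype_card (α := ULift (Fin n)), Fintype.card_ulift, Fintype.card_fin]
    exact hn
  obtain ⟨f⟩ : Nonempty (H.V ≃ ULift.{u} (Fin n)) := Finite.card_eq.1 hcard
  refine nonempty_iso_of_bijective (K := complete n) f
    (fun e => ⟨f '' H.inc e, (Set.ncard_image_of_injective _ f.injective).trans (htwo e)⟩)
    f.bijective ⟨fun e e' h => ?_, ?_⟩ fun e => rfl
  · exact hinj e e' (f.injective.image_injective (congrArg Subtype.val h))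
  · rintro ⟨s, hs⟩
    obtain ⟨x, y, hxy, rfl⟩ := Set.ncard_eq_two.1 hs
    obtain ⟨e, he⟩ := hadj (f.symm x) (f.symm y) (f.symm.injective.ne hxy)
    refine ⟨e, Subtype.ext ?_⟩
    change f '' H.inc e = {x, y}
    rw [he, Set.image_pair]
    simp

end MultiHypergraph

/-! ### Blocks of low vertices in a critical hypergraph -/

namespace HypergraphProperty

open MultiHypergraph

variable {P : HypergraphProperty.{u}} {H : MultiHypergraph.{u}} {C : Type v} {L : H.V → Set C}

/-- A critical hypergraph of an additive property is connected. -/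
theorem Critical.eq_univ (hP : P.IsSmooth) (hadd : P.IsAdditive) (h : P.Critical H L)
    (hL : ∀ v, (L v).Nonempty) {B : Set H.V} (hB : B.Nonempty)
    (hclosed : ∀ e, ∀ v ∈ H.inc e, v ∈ B → H.inc e ⊆ B) : B = Set.univ := by
  classical
  by_contra hne
  obtain ⟨w, hw⟩ := (Set.ne_univ_iff_exists_notMem _).1 hne
  obtain ⟨a, ha⟩ := hB
  obtain ⟨φ, hφ, hφL⟩ := h.exists_isColoringOff w (hL w)
  obtain ⟨ψ, hψ, hψL⟩ := h.exists_isColoringOff a (hL a)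
  -- The coloring of H - w is complete on B and that of H - a is complete off B. No edge crosses, so
  -- additivity glues them.
  refine h.2 ⟨fun x => if x ∈ B then φ x else ψ x, fun c => ?_, fun x => ?_⟩
  · have hset : (fun x => if x ∈ B then φ x else ψ x) ⁻¹' {c} =
        (φ ⁻¹' {c} ∩ B) ∪ (ψ ⁻¹' {c} \ B) := by
      ext x
      by_cases hx : x ∈ B <;> simp [hx]
    rw [hset]
    have h1 : φ ⁻¹' {c} ∩ B ⊆ φ ⁻¹' {c} \ {w} := fun x hx => ⟨hx.1, fun hh => hw (hh ▸ hx.2)⟩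
    have h2 : ψ ⁻¹' {c} \ B ⊆ ψ ⁻¹' {c} \ {a} := fun x hx => ⟨hx.1, fun hh => hx.2 (hh ▸ ha)⟩
    refine hadd.mem_induce_union ?_ (fun e he => ?_) (hP.mem_induce_of_subset h1 (hφ c))
      (hP.mem_induce_of_subset h2 (hψ c))
    · exact Set.disjoint_left.2 fun x hx hx' => hx'.2 hx.2
    · by_cases hmeet : ∃ v ∈ H.inc e, v ∈ B
      · obtain ⟨v, hv, hvB⟩ := hmeet
        exact Or.inl fun x hx => (he hx).resolve_right fun hh => hh.2 (hclosed e v hv hvB hx)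
      · exact Or.inr fun x hx => (he hx).resolve_left fun hh => hmeet ⟨x, hx, hh.2⟩
  · by_cases hx : x ∈ B
    · simp only [hx, if_true]
      exact hφL x fun hh => hw (hh ▸ hx)
    · simp only [hx, if_false]
      exact hψL x fun hh => hx (hh ▸ ha)

/-- The structure of biconnected sets `B` of low vertices in a critical hypergraph: the degrees in
`H(B)` are at most `d(P)`, or `H(B)` is regular of degree less than `δ` and of order greater
than its degree. -/
theorem Critical.degreeOn_le_or_regular (hP : P.IsSmooth) (hadd : P.IsAdditive)
    (h : P.Critical H L) {k δ : ℕ} (hk : 2 ≤ k) (hLk : ∀ v, (L v).ncard = k) (hδ : P.d * k = δ)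
    (hδ3 : 3 ≤ δ) (hH : ¬ Nonempty (H.Iso (complete (δ + 1)))) {B : Set H.V}
    (hBlow : B ⊆ P.lowVertices H L) (hB : H.twoSection.BiconnectedOn B) (hBne : B.Nonempty)
    (hsimple : ∀ e e', H.inc e ⊆ B → H.inc e = H.inc e' → e = e') :
    (∀ v ∈ B, H.degreeOn B v ≤ P.d) ∨
      ∃ b < δ, (∀ v ∈ B, H.degreeOn B v = b) ∧ b + 1 ≤ B.ncard := by
  have hfin : ∀ v, (L v).Finite := fun v => Set.finite_of_ncard_ne_zero (by rw [hLk v]; omega)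
  have hne : ∀ v, (L v).Nonempty :=
    fun v => Set.nonempty_of_ncard_ne_zero (by rw [hLk v]; omega)
  have hdeg : ∀ v ∈ B, H.degree v = δ := fun v hv => by
    have : H.degree v = P.d * (L v).ncard := hBlow hv
    rw [this, hLk v, hδ]
  obtain ⟨v, hv⟩ := hBne
  obtain ⟨φ, hφ⟩ := h.exists_isColoringOff v (hne v)
  have hconf : (tokenGame hP h.2 hfin B hBlow φ).conf v φ := ⟨hv, hφ, fun _ _ => rfl⟩
  rcases TokenGame.degreeOn_le_or_complete_or_cycle (T := tokenGame hP h.2 hfin B hBlow φ) hB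
    hsimple hconf with h1 | ⟨hpair, hcomp, hreg⟩ | ⟨hreg, hcard⟩
  · exact Or.inl h1
  · refine Or.inr ⟨B.ncard - 1, ?_, fun w hw => ?_, ?_⟩
    · by_contra! hge
      -- If the block has degree at least δ, it uses every edge at its vertices. By connectedness it
      -- is all of H, which is then K_{δ+1}.
      have hfull : ∀ w ∈ B, ∀ e, w ∈ H.inc e → ∃ x ∈ B, x ≠ w ∧ x ∈ H.inc e := by
        intro w hw e hwe
        have hle := hreg w hw
        change H.degreeOn B w + 1 = B.ncard at hle
        have := Set.eq_of_subset_of_ncard_le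
          (s := {e | w ∈ H.inc e ∧ ∃ x ∈ B, x ≠ w ∧ x ∈ H.inc e}) (t := {e | w ∈ H.inc e})
          (fun _ he => he.1) (by
            change H.degree w ≤ H.degreeOn B w
            rw [hdeg w hw]
            omega) (Set.toFinite _)
        have he : e ∈ {e | w ∈ H.inc e} := hwe
        rw [← this] at he
        exact he.2
      have hpairs : ∀ w ∈ B, ∀ e, w ∈ H.inc e → ∃ x ∈ B, x ≠ w ∧ H.inc e = {w, x} := by
        intro w hw e hwe
        obtain ⟨x, hx, hxw, hxe⟩ := hfull w hw e hwe
        exact ⟨x, hx, hxw, hpair e w hw x hx hxw.symm hwe hxe⟩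
      have huniv : B = Set.univ := h.eq_univ hP hadd hne ⟨v, hv⟩ fun e w hwe hw => by
        obtain ⟨x, hx, -, he⟩ := hpairs w hw e hwe
        rw [he]
        exact Set.insert_subset hw (Set.singleton_subset_iff.2 hx)
      have hmem : ∀ w, w ∈ B := fun w => huniv ▸ Set.mem_univ w
      refine hH (nonempty_iso_complete ?_ (fun e e' => hsimple e e' fun w _ => hmem w) (fun e => ?_)
        (fun x y hxy => ?_))
      · have h2 := hreg v hv
        have h3 := H.degreeOn_le_degree B v
        change H.degreeOn B v + 1 = B.ncard at h2
        rw [hdeg v hv] at h3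
        rw [order, ← Set.ncard_univ, ← huniv]
        omega
      · obtain ⟨w, hw, -⟩ := H.exists_mem_inc_ne e v
        obtain ⟨x, -, hxw, he⟩ := hpairs w (hmem w) e hw
        rw [he, Set.ncard_pair hxw.symm]
      · obtain ⟨-, e, hxe, hye⟩ := hcomp x (hmem x) y (hmem y) hxy
        exact ⟨e, hpair e x (hmem x) y (hmem y) hxy hxe hye⟩
    · have := hreg w hw
      change H.degreeOn B w + 1 = B.ncard at this
      omega
    · have : 0 < B.ncard := (Set.ncard_pos (Set.toFinite _)).2 ⟨v, hv⟩
      omega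
  · exact Or.inr ⟨2, by omega, hreg, hcard⟩

end HypergraphProperty

/-! ### The potential of a degree -/

theorem finsum_mem_ge_of_forall_ge {α : Type*} [Finite α] {s : Set α} {f : α → ℤ} {c : ℤ}
    (h : ∀ a ∈ s, c ≤ f a) : c * s.ncard ≤ ∑ᶠ a ∈ s, f a := by
  rw [finsum_mem_eq_finite_toFinset_sum _ (Set.toFinite s),
    Set.ncard_eq_toFinset_card s (Set.toFinite s), mul_comm, ← nsmul_eq_mul]
  exact Finset.card_nsmul_le_sum _ _ _ fun a ha => h a ((Set.toFinite s).mem_toFinset.1 ha)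

theorem finsum_mem_eq_add_sdiff_singleton {α M : Type*} [Finite α] [AddCommMonoid M] {s : Set α}
    {a : α} (ha : a ∈ s) (f : α → M) : ∑ᶠ i ∈ s, f i = f a + ∑ᶠ i ∈ s \ {a}, f i := by
  rw [← finsum_mem_insert f (fun h => h.2 rfl) (Set.toFinite _), Set.insert_sdiff_self_of_mem ha]

/-- The contribution of a vertex of degree `d` to the potential of a set of low vertices. -/
def gallaiPotential (δ d : ℕ) : ℤ :=
  -- The constant gives value 2 at degree δ - 1. The cap for degrees 0 and 1 limits the loss at a
  -- cut vertex when a block of degree δ - 1 is attached.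
  if d ≤ 1 then δ else (δ : ℤ) ^ 2 - δ + 2 - δ * d

theorem gallaiPotential_of_le_one {δ d : ℕ} (h : d ≤ 1) : gallaiPotential δ d = δ := if_pos h

theorem gallaiPotential_of_two_le {δ d : ℕ} (h : 2 ≤ d) :
    gallaiPotential δ d = (δ : ℤ) ^ 2 - δ + 2 - δ * d := if_neg (by omega)

theorem gallaiPotential_le {δ : ℕ} (hδ : 3 ≤ δ) (d : ℕ) :
    gallaiPotential δ d ≤ (δ : ℤ) ^ 2 - δ + 2 - δ * d := by
  have hδ' : (3 : ℤ) ≤ δ := by exact_mod_cast hδ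
  by_cases h : d ≤ 1
  · have hd : (d : ℤ) ≤ 1 := by exact_mod_cast h
    rw [gallaiPotential_of_le_one h]
    nlinarith
  · rw [gallaiPotential_of_two_le (by omega)]

/-- The slope is -δ from degree two on, and the cap only lowers the starting value, so each new edge
costs at most δ. -/
theorem gallaiPotential_add_ge {δ : ℕ} (hδ : 3 ≤ δ) (d s : ℕ) :
    -((δ : ℤ) * s) ≤ gallaiPotential δ (d + s) - gallaiPotential δ d := by
  have hδ' : (3 : ℤ) ≤ δ := by exact_mod_cast hδ
  have hs : (0 : ℤ) ≤ s := Int.natCast_nonneg s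
  by_cases h : d + s ≤ 1
  · rw [gallaiPotential_of_le_one h, gallaiPotential_of_le_one (by omega)]
    nlinarith
  · rw [gallaiPotential_of_two_le (by omega)]
    by_cases h' : d ≤ 1
    · rw [gallaiPotential_of_le_one h']
      have hd : (d : ℤ) ≤ 1 := by exact_mod_cast h'
      push_cast
      nlinarith
    · rw [gallaiPotential_of_two_le (by omega)]
      push_cast
      nlinarith

theorem le_gallaiPotential {δ d : ℕ} (hδ : 3 ≤ δ) (h : d + 2 ≤ δ) :
    (δ : ℤ) ≤ gallaiPotential δ d := by
  by_cases h1 : d ≤ 1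
  · rw [gallaiPotential_of_le_one h1]
  · rw [gallaiPotential_of_two_le (by omega)]
    have hδ' : (3 : ℤ) ≤ δ := by exact_mod_cast hδ
    have hd : (d : ℤ) + 2 ≤ δ := by exact_mod_cast h
    nlinarith

/-- The potential does not increase when a regular end block is removed. -/
theorem gallaiPotential_regular {δ b d a : ℕ} (hδ : 3 ≤ δ) (hb : b < δ) (ha : b ≤ a)
    (hd : d + b ≤ δ) :
    0 ≤ gallaiPotential δ b * a + gallaiPotential δ (d + b) - gallaiPotential δ d := by
  have hδ' : (3 : ℤ) ≤ δ := by exact_mod_cast hδ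
  have ha' : (b : ℤ) ≤ a := by exact_mod_cast ha
  by_cases h : b + 2 ≤ δ
  · have h1 := le_gallaiPotential hδ h
    have h2 := gallaiPotential_add_ge hδ d b
    have h3 : (δ : ℤ) * b ≤ gallaiPotential δ b * a :=
      mul_le_mul h1 ha' (Int.natCast_nonneg b) (by linarith)
    linarith
  -- The tight case: the block contributes 2 per vertex and the cut vertex has at most one other
  -- edge. For a = δ - 1 and d = 1 the total is exactly 0.
  · have hb' : (b : ℤ) = δ - 1 := by omega
    have hd' : (d : ℤ) ≤ 1 := by omega
    rw [gallaiPotential_of_two_le (d := b) (by omega),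
      gallaiPotential_of_two_le (d := d + b) (by omega),
      gallaiPotential_of_le_one (d := d) (by omega)]
    push_cast
    rw [hb'] at ha' ⊢
    nlinarith

/-! ### Removing end blocks -/

namespace MultiHypergraph

variable {H : MultiHypergraph.{u}}

/-- `H(S)` has no parallel edges. -/
def SimpleOn (H : MultiHypergraph.{u}) (S : Set H.V) : Prop :=
  ∀ e e', 2 ≤ (H.inc e ∩ S).ncard → H.inc e ∩ S = H.inc e' ∩ S → e = e'

theorem SimpleOn.of_subset {S R : Set H.V} (h : H.SimpleOn S) (hRS : R ⊆ S)
    (hR : ∀ e, 2 ≤ (H.inc e ∩ R).ncard → H.inc e ∩ S ⊆ R) : H.SimpleOn R := by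
  intro e e' he hee
  have key : ∀ e, 2 ≤ (H.inc e ∩ R).ncard → H.inc e ∩ S = H.inc e ∩ R := fun e he =>
    Set.Subset.antisymm (fun x hx => ⟨hx.1, hR e he hx⟩) (Set.inter_subset_inter_right _ hRS)
  refine h e e' (by rwa [key e he]) ?_
  rw [key e he, key e' (hee ▸ he), hee]

theorem degreeOn_congr {S R : Set H.V} {v : H.V}
    (h : ∀ w, H.twoSection.Adj v w → (w ∈ S ↔ w ∈ R)) : H.degreeOn S v = H.degreeOn R v := by
  unfold degreeOn
  congr 1
  ext e
  refine and_congr_right fun hve => exists_congr fun w => ?_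
  constructor
  · rintro ⟨hw, hwv, hwe⟩
    exact ⟨(h w ⟨hwv.symm, e, hve, hwe⟩).1 hw, hwv, hwe⟩
  · rintro ⟨hw, hwv, hwe⟩
    exact ⟨(h w ⟨hwv.symm, e, hve, hwe⟩).2 hw, hwv, hwe⟩

/-- The sum of the potentials of the vertices of `H(S)`. -/
noncomputable def potential (H : MultiHypergraph.{u}) (δ : ℕ) (S : Set H.V) : ℤ :=
  ∑ᶠ v ∈ S, gallaiPotential δ (H.degreeOn S v)

theorem potential_eq_add {δ : ℕ} {S A : Set H.V} (hA : A ⊆ S)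
    (hclosed : ∀ a ∈ A, ∀ b ∈ S, H.twoSection.Adj a b → b ∈ A) :
    H.potential δ S = H.potential δ A + H.potential δ (S \ A) := by
  have h1 : ∀ v ∈ A, H.degreeOn S v = H.degreeOn A v := fun v hv =>
    degreeOn_congr fun w hvw => ⟨fun hw => hclosed v hv w hw hvw, fun hw => hA hw⟩
  have h2 : ∀ v ∈ S \ A, H.degreeOn S v = H.degreeOn (S \ A) v := fun v hv =>
    degreeOn_congr fun w hvw =>
      ⟨fun hw => ⟨hw, fun hwA => hv.2 (hclosed w hwA v hv.1 hvw.symm)⟩, fun hw => hw.1⟩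
  have h3 : ∑ᶠ v ∈ A, gallaiPotential δ (H.degreeOn S v) = H.potential δ A :=
    finsum_mem_congr rfl fun v hv => by rw [h1 v hv]
  have h4 : ∑ᶠ v ∈ S \ A, gallaiPotential δ (H.degreeOn S v) = H.potential δ (S \ A) :=
    finsum_mem_congr rfl fun v hv => by rw [h2 v hv]
  rw [← h3, ← h4, potential,
    ← finsum_mem_union disjoint_sdiff_self_right (Set.toFinite _) (Set.toFinite _),
    Set.union_sdiff_cancel hA]

/-- Only x changes its degree when A is removed. Its degrees on the two sides add up, since an edge
reaching both sides would make a vertex of A adjacent to one of S \ A other than x. -/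
theorem potential_eq_add_of_cutVertex {δ : ℕ} {S A : Set H.V} {x : H.V} (hA : A ⊆ S) (hx : x ∈ S)
    (hxA : x ∉ A) (hclosed : ∀ a ∈ A, ∀ b ∈ S, b ≠ x → H.twoSection.Adj a b → b ∈ A) :
    H.potential δ S = H.potential δ (S \ A) +
      (∑ᶠ v ∈ A, gallaiPotential δ (H.degreeOn (insert x A) v)) +
      gallaiPotential δ (H.degreeOn (S \ A) x + H.degreeOn (insert x A) x) -
      gallaiPotential δ (H.degreeOn (S \ A) x) := by
  have h1 : ∀ v ∈ A, H.degreeOn S v = H.degreeOn (insert x A) v := fun v hv =>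
    degreeOn_congr fun w hvw => ⟨fun hw => (em (w = x)).imp_right fun h => hclosed v hv w hw h hvw,
      fun hw => hw.elim (fun h => h ▸ hx) fun h => hA h⟩
  have h2 : ∀ v ∈ (S \ A) \ {x}, H.degreeOn S v = H.degreeOn (S \ A) v := fun v hv =>
    degreeOn_congr fun w hvw =>
      ⟨fun hw => ⟨hw, fun hwA => hv.1.2 (hclosed w hwA v hv.1.1 hv.2 hvw.symm)⟩, fun hw => hw.1⟩
  have h3 : H.degreeOn S x = H.degreeOn (S \ A) x + H.degreeOn (insert x A) x := by
    unfold degreeOn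
    rw [← Set.ncard_union_eq _ (Set.toFinite _) (Set.toFinite _)]
    · congr 1
      ext e
      constructor
      · rintro ⟨hxe, w, hw, hwx, hwe⟩
        by_cases hwA : w ∈ A
        · exact Or.inr ⟨hxe, w, Or.inr hwA, hwx, hwe⟩
        · exact Or.inl ⟨hxe, w, ⟨hw, hwA⟩, hwx, hwe⟩
      · rintro (⟨hxe, w, hw, hwx, hwe⟩ | ⟨hxe, w, hw, hwx, hwe⟩)
        · exact ⟨hxe, w, hw.1, hwx, hwe⟩
        · exact ⟨hxe, w, hA (hw.resolve_left hwx), hwx, hwe⟩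
    · refine Set.disjoint_left.2 ?_
      rintro e ⟨-, w, hw, hwx, hwe⟩ ⟨-, w', hw', hwx', hwe'⟩
      have hw'A := hw'.resolve_left hwx'
      exact hw.2 (hclosed w' hw'A w hw.1 hwx ⟨fun h => hw.2 (h ▸ hw'A), e, hwe', hwe⟩)
  have hxSA : x ∈ S \ A := ⟨hx, hxA⟩
  have h4 : ∀ f : H.V → ℤ, ∑ᶠ v ∈ S \ A, f v = f x + ∑ᶠ v ∈ (S \ A) \ {x}, f v :=
    finsum_mem_eq_add_sdiff_singleton hxSA
  have h5 : H.potential δ S = (∑ᶠ v ∈ A, gallaiPotential δ (H.degreeOn S v)) +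
      ∑ᶠ v ∈ S \ A, gallaiPotential δ (H.degreeOn S v) := by
    unfold potential
    rw [← finsum_mem_union disjoint_sdiff_self_right (Set.toFinite _) (Set.toFinite _),
      Set.union_sdiff_cancel hA]
  have h6 : H.potential δ (S \ A) = _ := h4 _
  rw [h5, h4, h6, ← h3, finsum_mem_congr rfl fun v hv => by rw [h1 v hv],
    finsum_mem_congr (s := (S \ A) \ {x}) rfl fun v hv => by rw [h2 v hv]]
  ring

/-- A connected set with at least two vertices has an end block `insert x A`. -/
theorem exists_endBlock {G : SimpleGraph H.V} {S : Set H.V} (hS : G.ConnectedOn S)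
    (hcard : 2 ≤ S.ncard) :
    ∃ A ⊆ S, ∃ x ∈ S, x ∉ A ∧ A.Nonempty ∧ (∀ a ∈ A, ∀ b ∈ S, b ≠ x → G.Adj a b → b ∈ A) ∧
      G.BiconnectedOn (insert x A) := by
  obtain ⟨x₀, hx₀⟩ := Set.nonempty_of_ncard_ne_zero (show S.ncard ≠ 0 by omega)
  obtain ⟨y₀, hy₀, hxy₀⟩ := Set.exists_ne_of_one_lt_ncard (show 1 < S.ncard by omega) x₀
  -- A minimal set cut off from the rest of S by one vertex x; a cut vertex of `insert x A` would
  -- cut off a smaller one.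
  obtain ⟨A, -, hA⟩ := exists_minimal_le_of_wellFoundedLT
    (fun A : Set H.V => A.Nonempty ∧ A ⊆ S ∧ ∃ x ∈ S, x ∉ A ∧
      ∀ a ∈ A, ∀ b ∈ S, b ≠ x → G.Adj a b → b ∈ A) (S \ {x₀})
    ⟨⟨y₀, hy₀, hxy₀⟩, Set.sdiff_subset, x₀, hx₀, fun h => h.2 rfl,
      fun a _ b hb hbx _ => ⟨hb, hbx⟩⟩
  obtain ⟨⟨hAne, hAS, x, hx, hxA, hcl⟩, hmin⟩ := hA
  have hmin' : ∀ A₁ ⊆ A, A₁.Nonempty → (∃ y ∈ S, y ∉ A₁ ∧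
      ∀ a ∈ A₁, ∀ b ∈ S, b ≠ y → G.Adj a b → b ∈ A₁) → A ⊆ A₁ :=
    fun A₁ h1 h2 h3 => hmin ⟨h2, h1.trans hAS, h3⟩ h1
  obtain ⟨a₀, ha₀, ha₀x⟩ : ∃ a ∈ A, G.Adj a x := by
    by_contra! hcon
    have := hS A hAS hAne fun a ha b hb hab => hcl a ha b hb (fun h => hcon a ha (h ▸ hab)) hab
    exact hxA (this ▸ hx)
  have hAconn : G.ConnectedOn A := by
    intro A₁ h1 h2 h3
    exact Set.Subset.antisymm h1 (hmin' A₁ h1 h2 ⟨x, hx, fun h => hxA (h1 h),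
      fun a ha b hb hbx hab => h3 a ha b (hcl a (h1 ha) b hb hbx hab) hab⟩)
  refine ⟨A, hAS, x, hx, hxA, hAne, hcl, ?_, ?_⟩
  · intro A₁ h1 h2 h3
    have hinter : (A₁ ∩ A).Nonempty := by
      obtain ⟨z, hz⟩ := h2
      rcases h1 hz with rfl | hzA
      · exact ⟨a₀, h3 z hz a₀ (Or.inr ha₀) ha₀x.symm, ha₀⟩
      · exact ⟨z, hz, hzA⟩
    have := hAconn (A₁ ∩ A) Set.inter_subset_right hinter
      fun a ha b hb hab => ⟨h3 a ha.1 b (Or.inr hb) hab, hb⟩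
    have hsub : A ⊆ A₁ := Set.inter_eq_right.1 this
    exact Set.Subset.antisymm h1
      (Set.insert_subset (h3 a₀ (hsub ha₀) x (Or.inl rfl) ha₀x) hsub)
  · intro y hy
    by_cases hyx : y = x
    · subst hyx
      rwa [Set.insert_sdiff_self_of_notMem hxA]
    have hyA : y ∈ A := hy.resolve_left hyx
    have key : ∀ A₁ ⊆ insert x A \ {y}, x ∉ A₁ → A₁.Nonempty →
        (∀ a ∈ A₁, ∀ b ∈ insert x A \ {y}, G.Adj a b → b ∈ A₁) → False := by
      intro A₁ h1 hx1 h2 h3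
      have h4 : A₁ ⊆ A := fun z hz => (h1 hz).1.resolve_left fun h => hx1 (h ▸ hz)
      refine (h1 (hmin' A₁ h4 h2 ⟨y, hAS hyA, fun h => (h1 h).2 rfl,
        fun a ha b hb hby hab => ?_⟩ hyA)).2 rfl
      refine h3 a ha b ⟨?_, hby⟩ hab
      exact (em (b = x)).imp_right fun h => hcl a (h4 ha) b hb h hab
    intro A₁ h1 h2 h3
    by_cases hx1 : x ∈ A₁
    · by_contra hne
      have h5 : ((insert x A \ {y}) \ A₁).Nonempty := by
        rw [Set.sdiff_nonempty]
        exact fun h => hne (Set.Subset.antisymm h1 h)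
      exact key _ Set.sdiff_subset (fun h => h.2 hx1) h5 fun a ha b hb hab =>
        ⟨hb, fun hb1 => ha.2 (h3 b hb1 a ha.1 hab.symm)⟩
    · exact (key A₁ h1 hx1 h2 h3).elim

/-- The degree of a vertex in the rest of a block whose other vertices have degree at most one. -/
theorem degreeOn_insert_le_ncard {A : Set H.V} {x : H.V} (hxA : x ∉ A)
    (h : ∀ v ∈ A, H.degreeOn (insert x A) v ≤ 1) : H.degreeOn (insert x A) x ≤ A.ncard := by
  have hch : ∀ e : {e | x ∈ H.inc e ∧ ∃ w ∈ insert x A, w ≠ x ∧ w ∈ H.inc e},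
      ∃ w ∈ A, w ∈ H.inc e.1 := fun e => by
    obtain ⟨w, hw, hwx, hwe⟩ := e.2.2
    exact ⟨w, hw.resolve_left hwx, hwe⟩
  choose f hf hfe using hch
  refine Nat.card_le_card_of_injective (fun e => (⟨f e, hf e⟩ : A)) fun e e' hee => ?_
  have heq : f e = f e' := congrArg Subtype.val hee
  have hne : x ≠ f e := fun hh => hxA (hh ▸ hf e)
  have := (Set.ncard_le_one (Set.toFinite _)).1 (h (f e) (hf e))
  exact Subtype.ext (this e.1 ⟨hfe e, x, Or.inl rfl, hne, e.2.1⟩ e'.1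
    ⟨heq ▸ hfe e', x, Or.inl rfl, hne, e'.2.1⟩)

/-- The sum of the potentials is non-negative if all biconnected parts have small degrees or are
regular. -/
theorem potential_nonneg {δ r : ℕ} (hδ : 3 ≤ δ) (hr : 2 * r ≤ δ) {U : Set H.V}
    (hdeg : ∀ v ∈ U, H.degree v ≤ δ)
    (hblock : ∀ B ⊆ U, H.twoSection.BiconnectedOn B → B.Nonempty →
      (∀ e e', H.inc e ⊆ B → H.inc e = H.inc e' → e = e') →
      (∀ v ∈ B, H.degreeOn B v ≤ r) ∨
        ∃ b < δ, (∀ v ∈ B, H.degreeOn B v = b) ∧ b + 1 ≤ B.ncard)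
    {S : Set H.V} (hSU : S ⊆ U) (hS : H.SimpleOn S) : 0 ≤ H.potential δ S := by
  induction hn : S.ncard using Nat.strong_induction_on generalizing S with
  | _ n ih =>
  subst hn
  have hδ' : (3 : ℤ) ≤ δ := by exact_mod_cast hδ
  have ih' : ∀ R ⊆ S, R ≠ S → (∀ e, 2 ≤ (H.inc e ∩ R).ncard → H.inc e ∩ S ⊆ R) →
      0 ≤ H.potential δ R := fun R hR hne h =>
    ih _ (Set.ncard_lt_ncard (hR.ssubset_of_ne hne) (Set.toFinite _)) (hR.trans hSU)
      (hS.of_subset hR h) rfl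
  have hadj : ∀ e a b, a ∈ H.inc e → b ∈ H.inc e → a ≠ b → H.twoSection.Adj a b :=
    fun e a b ha hb hab => ⟨hab, e, ha, hb⟩
  by_cases hconn : H.twoSection.ConnectedOn S
  swap
  · simp only [SimpleGraph.ConnectedOn] at hconn
    push Not at hconn
    obtain ⟨A, hA, hAne, hcl, hAS⟩ := hconn
    rw [potential_eq_add hA hcl]
    have hmeet : ∀ e a, a ∈ H.inc e → a ∈ A → H.inc e ∩ S ⊆ A := by
      intro e a hae haA b hb
      by_cases hab : a = b
      · exact hab ▸ haA
      · exact hcl a haA b hb.2 (hadj e a b hae hb.1 hab)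
    refine add_nonneg (ih' A hA hAS fun e he => ?_) (ih' _ Set.sdiff_subset ?_ fun e he => ?_)
    · obtain ⟨a, ha⟩ := Set.nonempty_of_ncard_ne_zero (show (H.inc e ∩ A).ncard ≠ 0 by omega)
      exact hmeet e a ha.1 ha.2
    · intro h
      obtain ⟨a, ha⟩ := hAne
      exact (h.symm ▸ hA ha : a ∈ S \ A).2 ha
    · obtain ⟨a, ha⟩ := Set.nonempty_of_ncard_ne_zero
        (show (H.inc e ∩ (S \ A)).ncard ≠ 0 by omega)
      exact fun b hb => ⟨hb.2, fun hbA => ha.2.2 (hmeet e b hb.1 hbA ⟨ha.1, ha.2.1⟩)⟩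
  by_cases hcard : 2 ≤ S.ncard
  swap
  · refine finsum_mem_induction (fun z => (0 : ℤ) ≤ z) le_rfl (fun _ _ => add_nonneg) fun v hv => ?_
    have h0 : {e | v ∈ H.inc e ∧ ∃ w ∈ S, w ≠ v ∧ w ∈ H.inc e} = ∅ := by
      refine Set.eq_empty_of_forall_notMem ?_
      rintro e ⟨-, w, hw, hwv, -⟩
      exact hwv ((Set.ncard_le_one (Set.toFinite _)).1 (by omega) w hw v hv)
    rw [degreeOn, h0, Set.ncard_empty, gallaiPotential_of_le_one zero_le_one]
    exact Int.natCast_nonneg _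
  obtain ⟨A, hA, x, hx, hxA, hAne, hcl, hB⟩ := exists_endBlock hconn hcard
  have hBS : insert x A ⊆ S := Set.insert_subset hx hA
  have hmeet : ∀ e a, a ∈ H.inc e → a ∈ A → H.inc e ∩ S ⊆ insert x A := by
    intro e a hae haA b hb
    by_cases hbx : b = x
    · exact Or.inl hbx
    by_cases hab : a = b
    · exact Or.inr (hab ▸ haA)
    · exact Or.inr (hcl a haA b hb.2 hbx (hadj e a b hae hb.1 hab))
  have hrest : 0 ≤ H.potential δ (S \ A) := by
    refine ih' _ Set.sdiff_subset ?_ fun e he => ?_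
    · intro h
      obtain ⟨a, ha⟩ := hAne
      exact (h.symm ▸ hA ha : a ∈ S \ A).2 ha
    · obtain ⟨y, hy, hyx⟩ := Set.exists_ne_of_one_lt_ncard 
        (show 1 < (H.inc e ∩ (S \ A)).ncard by omega) x
      exact fun b hb => ⟨hb.2, fun hbA =>
        ((hmeet e b hb.1 hbA ⟨hy.1, hy.2.1⟩).elim hyx fun h => hy.2.2 h)⟩
  rw [potential_eq_add_of_cutVertex hA hx hxA hcl]
  suffices hgain : 0 ≤ (∑ᶠ v ∈ A, gallaiPotential δ (H.degreeOn (insert x A) v)) +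
      gallaiPotential δ (H.degreeOn (S \ A) x + H.degreeOn (insert x A) x) -
      gallaiPotential δ (H.degreeOn (S \ A) x) by linarith
  have hsB : ∀ e e', H.inc e ⊆ insert x A → H.inc e = H.inc e' → e = e' := fun e e' he hee => by
    refine hS e e' ?_ (by rw [hee])
    rw [Set.inter_eq_left.2 (he.trans hBS)]
    exact H.two_le_ncard_inc e
  rcases hblock _ (hBS.trans hSU) hB ⟨x, Or.inl rfl⟩ hsB with hle | ⟨b, hb, hreg, hbc⟩
  · have h1 := gallaiPotential_add_ge hδ (H.degreeOn (S \ A) x) (H.degreeOn (insert x A) x)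
    have hge : ∀ v ∈ A, (δ : ℤ) ≤ gallaiPotential δ (H.degreeOn (insert x A) v) := by
      intro v hv
      have h2 := hle v (Or.inr hv)
      by_cases h3 : H.degreeOn (insert x A) v ≤ 1
      · rw [gallaiPotential_of_le_one h3]
      · exact le_gallaiPotential hδ (by omega)
    by_cases hall : ∀ v ∈ A, H.degreeOn (insert x A) v ≤ 1
    · have h2 : ((H.degreeOn (insert x A) x : ℕ) : ℤ) ≤ A.ncard := by
        exact_mod_cast degreeOn_insert_le_ncard hxA hall
      have h3 := finsum_mem_ge_of_forall_ge hge
      nlinarith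
    · push Not at hall
      obtain ⟨v, hv, hv2⟩ := hall
      -- If A were just v, two edges at v would both have trace {v, x} on S, against simplicity. The
      -- second vertex contributes the extra δ, and the degrees of v and x sum to at most 2r ≤ δ.
      obtain ⟨w, hw, hwv⟩ : ∃ w ∈ A, w ≠ v := by
        by_contra! hcon
        have hAv : ∀ e, v ∈ H.inc e → (∃ w ∈ insert x A, w ≠ v ∧ w ∈ H.inc e) →
            H.inc e ∩ S = {v, x} := by
          rintro e hve ⟨w, hw, hwv, hwe⟩
          have hwx : w = x := hw.resolve_right fun h => hwv (hcon w h)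
          subst hwx
          refine Set.Subset.antisymm (fun z hz => ?_) ?_
          · exact (hmeet e v hve hv hz).elim (fun h => Or.inr h) fun h => Or.inl (hcon z h)
          · rintro z (rfl | rfl)
            · exact ⟨hve, hA hv⟩
            · exact ⟨hwe, hx⟩
        refine absurd ((Set.ncard_le_one (Set.toFinite _)).2 ?_) (not_le.2 hv2)
        rintro e ⟨he, he'⟩ e₁ ⟨he₁, he₁'⟩
        refine hS e e₁ ?_ (by rw [hAv e he he', hAv e₁ he₁ he₁'])
        have hvx : v ≠ x := fun h => hxA (h ▸ hv)
        rw [hAv e he he', Set.ncard_pair hvx]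
      have h2 : (δ : ℤ) + gallaiPotential δ (H.degreeOn (insert x A) v) ≤
          ∑ᶠ v ∈ A, gallaiPotential δ (H.degreeOn (insert x A) v) := by
        have h5 := finsum_mem_ge_of_forall_ge (s := A \ {v}) fun z hz => hge z hz.1
        have h6 : 1 ≤ (A \ {v}).ncard := (Set.ncard_pos (Set.toFinite _)).2 ⟨w, hw, hwv⟩
        have h7 : (1 : ℤ) ≤ ((A \ {v}).ncard : ℤ) := by exact_mod_cast h6
        rw [finsum_mem_eq_add_sdiff_singleton hv]
        nlinarith
      rw [gallaiPotential_of_two_le hv2] at h2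
      have h3 : (H.degreeOn (insert x A) v : ℤ) + H.degreeOn (insert x A) x ≤ δ := by
        have := hle v (Or.inr hv)
        have := hle x (Or.inl rfl)
        omega
      nlinarith
  · have h1 : ∑ᶠ v ∈ A, gallaiPotential δ (H.degreeOn (insert x A) v) ≥
        gallaiPotential δ b * A.ncard :=
      finsum_mem_ge_of_forall_ge fun v hv => (by rw [hreg v (Or.inr hv)])
    rw [Set.ncard_insert_of_notMem hxA] at hbc
    have h2 : H.degreeOn (S \ A) x + b ≤ δ := by
      have h3 : H.degreeOn (S \ A) x + H.degreeOn (insert x A) x ≤ H.degree x := by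
        unfold degreeOn
        rw [← Set.ncard_union_eq _ (Set.toFinite _) (Set.toFinite _)]
        · refine Set.ncard_le_ncard ?_ (Set.toFinite _)
          rintro e (he | he)
          · exact he.1
          · exact he.1
        · refine Set.disjoint_left.2 ?_
          rintro e ⟨-, w, hw, hwx, hwe⟩ ⟨-, w', hw', hwx', hwe'⟩
          exact (hmeet e w' hwe' (hw'.resolve_left hwx') ⟨hwe, hw.1⟩).elim hwx hw.2
      rw [hreg x (Or.inl rfl)] at h3
      exact h3.trans (hdeg x (hSU hx))
    have h3 := gallaiPotential_regular hδ hb (by omega : b ≤ A.ncard) h2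
    rw [hreg x (Or.inl rfl)]
    linarith

end MultiHypergraph

/-! ### Double counting and the final estimate -/

theorem finsum_mem_ncard {α β : Type*} [Finite α] [Finite β] (R : α → β → Prop) (s : Set α) :
    ∑ᶠ a ∈ s, {b | R a b}.ncard = {p : α × β | p.1 ∈ s ∧ R p.1 p.2}.ncard := by
  induction s, s.toFinite using Set.Finite.induction_on with
  | empty => simp
  | @insert a s ha hs ih =>
    rw [finsum_mem_insert _ ha hs, ih,
      ← Set.ncard_image_of_injective {b | R a b} (Prod.mk_right_injective a),
      ← Set.ncard_union_eq _ (Set.toFinite _) (Set.toFinite _)]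
    · congr 1
      ext ⟨x, b⟩
      constructor
      · rintro (⟨b', hb, h⟩ | ⟨hx, hb⟩)
        · obtain ⟨rfl, rfl⟩ := Prod.mk.inj h
          exact ⟨Or.inl rfl, hb⟩
        · exact ⟨Or.inr hx, hb⟩
      · rintro ⟨rfl | hx, hb⟩
        · exact Or.inl ⟨b, hb, rfl⟩
        · exact Or.inr ⟨hx, hb⟩
    · refine Set.disjoint_left.2 ?_
      rintro _ ⟨b, -, rfl⟩ ⟨h, -⟩
      exact ha h

namespace MultiHypergraph

variable {H : MultiHypergraph.{u}}

theorem degreeSum_eq_add (U : Set H.V) :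
    H.degreeSum = ∑ᶠ v ∈ U, H.degree v + ∑ᶠ v ∈ Uᶜ, H.degree v := by
  rw [← finsum_mem_union disjoint_compl_right (Set.toFinite _) (Set.toFinite _),
    Set.union_compl_self, finsum_mem_univ, degreeSum]

/-- An edge that meets `U` in one vertex has a vertex outside `U`. -/
theorem sum_degree_le_add (U : Set H.V) :
    ∑ᶠ v ∈ U, H.degree v ≤ ∑ᶠ v ∈ U, H.degreeOn U v + ∑ᶠ v ∈ Uᶜ, H.degree v := by
  have h1 : ∀ v ∈ U, H.degree v =
      H.degreeOn U v + {e | v ∈ H.inc e ∧ ∀ w ∈ U, w ≠ v → w ∉ H.inc e}.ncard := by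
    intro v _
    unfold degree degreeOn
    rw [← Set.ncard_union_eq _ (Set.toFinite _) (Set.toFinite _)]
    · congr 1
      ext e
      constructor
      · intro hve
        by_cases h : ∃ w ∈ U, w ≠ v ∧ w ∈ H.inc e
        · exact Or.inl ⟨hve, h⟩
        · exact Or.inr ⟨hve, fun w hw hwv hwe => h ⟨w, hw, hwv, hwe⟩⟩
      · rintro (h | h) <;> exact h.1
    · refine Set.disjoint_left.2 ?_
      rintro e ⟨-, w, hw, hwv, hwe⟩ ⟨-, h⟩
      exact h w hw hwv hwe
  rw [finsum_mem_congr rfl h1, finsum_mem_add_distrib (Set.toFinite _)]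
  refine Nat.add_le_add_left ?_ _
  unfold degree
  rw [finsum_mem_ncard, finsum_mem_ncard]
  -- Send an incidence (v, e) to one of e outside U. This is injective because v is the only vertex
  -- of e in U.
  choose f hf hfne using fun p : H.V × H.E => H.exists_mem_inc_ne p.2 p.1
  refine Set.ncard_le_ncard_of_injOn (fun p => (f p, p.2))
    (fun p hp => ⟨fun hU => hp.2.2 _ hU (hfne p) (hf p), hf p⟩) ?_ (Set.toFinite _)
  rintro ⟨v, e⟩ ⟨hv, hve, -⟩ ⟨v', e'⟩ ⟨hv', hve', h'⟩ heq
  obtain rfl : e = e' := congrArg Prod.snd heq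
  by_contra hne
  exact h' v hv (fun h => hne (by rw [show v = v' from h])) hve

end MultiHypergraph

namespace HypergraphProperty

open MultiHypergraph

variable {P : HypergraphProperty.{u}} {H : MultiHypergraph.{u}} {C : Type v} {L : H.V → Set C}

theorem LocallyLinear.simpleOn (h : P.LocallyLinear H L) : H.SimpleOn (P.lowVertices H L) := by
  intro e e' he hee
  have hee' : P.lowVertices H L ∩ H.inc e = P.lowVertices H L ∩ H.inc e' := by
    rwa [Set.inter_comm, Set.inter_comm _ (H.inc e')]
  exact congrArg Subtype.val
    (h ⟨e, he⟩ ⟨e', hee ▸ he⟩ ((Subtype.preimage_val_eq_preimage_val_iff _ _ _).2 hee'))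

end HypergraphProperty

open MultiHypergraph HypergraphProperty in
theorem theorem2p1 (P : HypergraphProperty.{u}) (hP : P.IsSmooth) (hPadd : P.IsAdditive)
    (r : ℕ) (hr : P.d = r) (hr1 : 1 ≤ r) (k : ℕ) (hk : 2 ≤ k)
    (δ : ℕ) (hδ : δ = k * r) (hδ3 : 3 ≤ δ)
    {C : Type v} (H : MultiHypergraph.{u}) (L : H.V → Set C)
    (hL : ∀ w, (L w).ncard = k)
    (hcrit : P.Critical H L) (hlin : P.LocallyLinear H L)
    (hH : ¬ Nonempty (H.Iso (MultiHypergraph.complete (δ + 1)))) :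
    (δ : ℝ) * (H.order : ℝ) +
        ((δ : ℝ) - 2) / ((δ : ℝ) ^ 2 + 2 * (δ : ℝ) - 2) * (H.order : ℝ) ≤
      (H.degreeSum : ℝ) := by
  have hdk : P.d * k = δ := by rw [hr, hδ, mul_comm]
  have hfin : ∀ v, (L v).Finite := fun v => Set.finite_of_ncard_ne_zero (by rw [hL v]; omega)
  have hne : ∀ v, (L v).Nonempty := fun v => Set.nonempty_of_ncard_ne_zero (by rw [hL v]; omega)
  have hdeg : ∀ v, δ ≤ H.degree v := fun v => by
    obtain ⟨φ, hφ⟩ := hcrit.exists_isColoringOff v (hne v)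
    have := hφ.mul_le_degree hP hcrit.2 (hfin v)
    rwa [hL v, hdk] at this
  set U := P.lowVertices H L with hU
  have hlow : ∀ v ∈ U, H.degree v = δ := fun v hv => by
    have : H.degree v = P.d * (L v).ncard := hv
    rw [this, hL v, hdk]
  have hhigh : ∀ v ∈ Uᶜ, δ + 1 ≤ H.degree v := fun v hv => by
    refine Nat.lt_of_le_of_ne (hdeg v) fun h => hv ?_
    change H.degree v = P.d * (L v).ncard
    rw [hL v, hdk, h]
  have hpot : 0 ≤ H.potential δ U := potential_nonneg (r := P.d) hδ3
    (by rw [← hdk, mul_comm 2]; exact Nat.mul_le_mul_left _ hk) (fun v hv => (hlow v hv).le)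
    (fun B hBU hB hBne hs => hcrit.degreeOn_le_or_regular hP hPadd hk hL hdk hδ3 hH hBU hB hBne hs)
    le_rfl hlin.simpleOn
  -- Replacing each potential by its linear upper bound turns non-negativity into a bound on the
  -- degree sum.
  have h1 : (δ : ℤ) * (∑ᶠ v ∈ U, H.degreeOn U v : ℕ) ≤ ((δ : ℤ) ^ 2 - δ + 2) * U.ncard := by
    unfold potential at hpot
    rw [finsum_mem_eq_finite_toFinset_sum _ (Set.toFinite U)] at hpot ⊢
    have h2 := hpot.trans (Finset.sum_le_sum fun v _ => gallaiPotential_le hδ3 (H.degreeOn U v))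
    rw [Finset.sum_sub_distrib, Finset.sum_const, ← Finset.mul_sum, nsmul_eq_mul,
      ← Set.ncard_eq_toFinset_card U (Set.toFinite U)] at h2
    push_cast
    linarith
  have h2 : ∑ᶠ v ∈ U, H.degree v = U.ncard * δ := by
    rw [finsum_mem_congr rfl hlow, finsum_mem_eq_finite_toFinset_sum _ (Set.toFinite U),
      Finset.sum_const, smul_eq_mul, ← Set.ncard_eq_toFinset_card U (Set.toFinite U)]
  have h3 : Uᶜ.ncard * (δ + 1) ≤ ∑ᶠ v ∈ Uᶜ, H.degree v := by
    rw [finsum_mem_eq_finite_toFinset_sum _ (Set.toFinite _),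
      Set.ncard_eq_toFinset_card _ (Set.toFinite _), ← smul_eq_mul]
    exact Finset.card_nsmul_le_sum _ _ _ fun v hv => hhigh v ((Set.toFinite _).mem_toFinset.1 hv)
  have h4 := sum_degree_le_add U
  have h5 : U.ncard + Uᶜ.ncard = H.order := Set.ncard_add_ncard_compl U
  rw [degreeSum_eq_add U, ← h5, h2]
  rw [h2] at h4
  generalize ∑ᶠ v ∈ U, H.degreeOn U v = D at h1 h4
  generalize ∑ᶠ v ∈ Uᶜ, H.degree v = X at h3 h4 ⊢
  generalize U.ncard = a at *
  generalize Uᶜ.ncard = b at *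
  have g1 : (δ : ℝ) * D ≤ ((δ : ℝ) ^ 2 - δ + 2) * a := by exact_mod_cast h1
  have g3 : (b : ℝ) * (δ + 1) ≤ X := by exact_mod_cast h3
  have g4 : (a : ℝ) * δ ≤ D + X := by exact_mod_cast h4
  have gδ : (3 : ℝ) ≤ δ := by exact_mod_cast hδ3
  have gQ : (0 : ℝ) < (δ : ℝ) ^ 2 + 2 * δ - 2 := by nlinarith
  -- The combination is `g1` plus δ times `g4` plus δ² + δ - 2 times `g3`: D cancels, and the
  -- coefficient of X is δ² + 2δ - 2.
  have g5 : ((δ : ℝ) - 2) * (a + b) ≤ ((δ : ℝ) ^ 2 + 2 * δ - 2) * (X - δ * b) := by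
    have e1 : 0 ≤ ((δ : ℝ) ^ 2 + δ - 2) * (X - b * (δ + 1)) :=
      mul_nonneg (by nlinarith) (by linarith)
    have e2 : 0 ≤ (δ : ℝ) * (D + X - a * δ) := mul_nonneg (by linarith) (by linarith)
    nlinarith
  have g6 : ((δ : ℝ) - 2) / ((δ : ℝ) ^ 2 + 2 * δ - 2) * (a + b) ≤ X - δ * b := by
    rw [div_mul_eq_mul_div, div_le_iff₀ gQ]
    linarith
  push_cast
  linarith
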